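/- Let $\lambda_1,\lambda_2,\mu_1,\mu_2>0$, $\rho_1=\lambda_1/\mu_1$ and $\alpha^*=\rho_1/(1-\rho_1)$. For $x=(x_1,x_2)\in\mathbb N^2$ and $i=1,2$ let $$W_i(x_1,x_2)=\frac{\log(1+x_i)}{\log(1+x_1)+\log(1+x_2)},\qquad 0/0=0 .$$ For each $N$, let $(L_1^N(t),L_2^N(t))_{t\ge 0}$ be a càdlàg process with values in $\mathbb N^2$ which solves $$\mathrm d L_i(t)=\mathcal N_{\lambda_i}(\mathrm d t)-\mathcal N_{\mu_iW_i(L_1(t-),L_2(t-))}(\mathrm d t),\qquad i=1,2,$$ that is, almost surely, for all $t\ge0$ and $i=1,2$, $$L_i(t)=L_i(0)+\mathcal N_{\lambda_i}((0,t])-\mathcal P_i\big(\{(y,s):0<s\le t,\ 0\le y\le \mu_iW_i(L_1(s-),L_2(s-))\}\big),$$ where $\mathcal N_{\lambda_i}$ is a Poisson process on $\mathbb R_+$ with rate $\lambda_i$, $\mathcal P_i$ is a homogeneous Poisson point process on $\mathbb R_+^2$ with rate $1$, and $\mathcal N_{\lambda_1},\mathcal N_{\lambda_2},\mathcal P_1,\mathcal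 P_2$ and the initial state are independent. Assume that $\rho_1<1/2$, that $L_2^N(0)=N$ almost surely for every $N$ and that $L_1^N(0)\sim\delta N^{\alpha^*}$ for some $\delta\in(0,1]$, in the sense that $L_1^N(0)/N^{\alpha^*}$ converges to $\delta$ in probability as $N\to\infty$ (in particular, $L_1^N(0)$ may be deterministic). Then there is a unique function $h:[0,\infty)\to\mathbb R$ such that * if $\delta=1$, then $h\equiv 1$; * if $\delta\neq1$, then, for all $t\ge 0$, $0<h(t)<1$ and $$\int_\delta^{h(t)}\frac{\mathrm d u}{\log u}=-\frac{\mu_1t}{(1+\alpha^*)^2}.$$ This function is continuous, and, as $N\to\infty$, the processes $$\left(\frac{L_1^N\big(N^{\alpha^*}(\log N)\,t\big)}{N^{\alpha^*}}\right)_{t\ge0}$$ converge in distribution to the deterministic process $(h(t))_{t\ge0}$, for the topology of uniform convergence on compact subsets of $[0,\infty)$: $\mathbb E[f(\cdot)]$ converges to $f(h)$ for every bounded function $f$ on the space $D([0,\infty),\mathbb R)$ of càdlàg functions that is continuous for this topology and measurable for the $\sigma$-algebra generated by the evaluations. -/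

import Mathlib

open MeasureTheory ProbabilityTheory Filter Topology Set
open scoped NNReal ENNReal BoundedContinuousFunction

noncomputable section

/-! ### Poisson point processes -/

/-- `ξ` is a Poisson point process (Poisson random measure) on `E` with intensity measure `ν`:
the number of points in a set of finite intensity is Poisson distributed with that mean, and the
numbers of points in disjoint sets are independent. -/
structure IsPoissonProcess {Ω E : Type*} [MeasurableSpace Ω] [MeasurableSpace E]
    (ξ : Ω → Measure E) (ν : Measure E) (P : Measure Ω) : Prop where
  measurable : Measurable ξ
  law : ∀ B : Set E, MeasurableSet B → ν B ≠ ∞ →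
    P.map (fun ω => ξ ω B) =
      (poissonMeasure (ν B).toNNReal).map (Nat.cast : ℕ → ℝ≥0∞)
  indep : ∀ (n : ℕ) (B : Fin n → Set E), (∀ i, MeasurableSet (B i)) →
    Pairwise (fun i j => Disjoint (B i) (B j)) → iIndepFun (fun i ω => ξ ω (B i)) P

/-! ### Càdlàg paths and convergence in distribution of processes -/

/-- Right-continuous with left limits, on the half-line `[0, ∞)`. -/
def IsCadlag {β : Type*} [TopologicalSpace β] (x : ℝ≥0 → β) : Prop :=
  ∀ t, ContinuousWithinAt x (Ici t) t ∧ ∃ l, Tendsto x (𝓝[<] t) (𝓝 l)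

/-- The space `D([0, ∞), ℝ)` of real càdlàg paths. -/
structure CadlagPath where
  toFun : ℝ≥0 → ℝ
  isCadlag : IsCadlag toFun

namespace CadlagPath

/-- The topology of uniform convergence on compact subsets of `[0, ∞)`. -/
instance : TopologicalSpace CadlagPath :=
  TopologicalSpace.induced
    (fun x => UniformOnFun.ofFun {K : Set ℝ≥0 | IsCompact K} x.toFun) inferInstance

/-- The projection σ-algebra, generated by the evaluations `x ↦ x t`. -/
instance : MeasurableSpace CadlagPath :=
  MeasurableSpace.comap CadlagPath.toFun MeasurableSpace.pi

/-- A continuous function as a càdlàg path. -/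
def ofContinuous (h : ℝ≥0 → ℝ) (hc : Continuous h) : CadlagPath where
  toFun := h
  isCadlag t := ⟨hc.continuousWithinAt, h t, hc.continuousAt.mono_left nhdsWithin_le_nhds⟩

end CadlagPath

/-- Convergence in distribution of processes with paths in `D([0, ∞), ℝ)` to the law `ν`, for the
topology of uniform convergence on compact sets. As this topology is not separable, the test
functions are the bounded continuous ones that are measurable for the projection σ-algebra; they
include all bounded functions that are continuous for the Skorokhod topology. -/
def ConvergesInLaw {Ω : ℕ → Type*} [∀ N, MeasurableSpace (Ω N)] (P : ∀ N, Measure (Ω N))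
    (Z : ∀ N, Ω N → CadlagPath) (ν : Measure CadlagPath) : Prop :=
  (∀ N, Measurable (Z N)) ∧
    ∀ f : CadlagPath →ᵇ ℝ, Measurable f →
      Tendsto (fun N => ∫ ω, f (Z N ω) ∂(P N)) atTop (𝓝 (∫ x, f x ∂ν))

/-! ### The two queues with logarithmic weights -/

/-- The fraction of service received by class `i` in state `x`; it is `0` if both queues are
empty, by the convention `0 / 0 = 0`. The first class has index `0`, the second one index `1`. -/
def serviceShare (x : Fin 2 → ℕ) (i : Fin 2) : ℝ :=
  Real.log (1 + x i) / (Real.log (1 + x 0) + Real.log (1 + x 1))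

/-- Number of departures of class `i` during `(0, t]`, along the path `x`: the number of points
`(y, s)` of `S`, with `0 < s ≤ t`, whose mark `y` is at most the service rate
`r * serviceShare (x (s-)) i`. -/
def departures (S : Measure (ℝ × ℝ)) (r : ℝ) (x : ℝ≥0 → Fin 2 → ℕ) (i : Fin 2) (t : ℝ≥0) : ℝ≥0∞ :=
  S {p | 0 < p.2 ∧ p.2 ≤ t ∧ 0 ≤ p.1 ∧
    p.1 ≤ r * serviceShare (Function.leftLim x p.2.toNNReal) i}

/-- `L` is a solution of the stochastic differential equations
`dL_i(t) = N_{λ_i}(dt) - N_{μ_i W_i(L(t-))}(dt)`, `i = 1, 2`, driven by the Poisson processes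
`A i` of arrivals, of rate `λ_i` on `[0, ∞)`, and by the Poisson processes `S i` of rate `1` on
`[0, ∞)²`, whose points below the graph of the service rate of class `i` give the departures; the
initial state and the four driving processes are independent. -/
structure IsQueueSolution {Ω : Type*} [MeasurableSpace Ω] (lam mu : Fin 2 → ℝ) (P : Measure Ω)
    (A : Fin 2 → Ω → Measure ℝ) (S : Fin 2 → Ω → Measure (ℝ × ℝ))
    (L : Ω → ℝ≥0 → Fin 2 → ℕ) : Prop where
  arrivals : ∀ i, IsPoissonProcess (A i) (ENNReal.ofReal (lam i) • volume.restrict (Ici 0)) P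
  services : ∀ i, IsPoissonProcess (S i) (volume.restrict (Ici 0 ×ˢ Ici 0)) P
  indep : iIndep (Sum.elim (fun _ : Unit => MeasurableSpace.comap (fun ω => L ω 0) inferInstance)
    (Sum.elim (fun i => MeasurableSpace.comap (A i) inferInstance)
      (fun i => MeasurableSpace.comap (S i) inferInstance))) P
  measurable : ∀ t, Measurable fun ω => L ω t
  cadlag : ∀ ω, IsCadlag (L ω)
  /-- The integrated equation, with the departures moved to the left. -/
  equation : ∀ᵐ ω ∂P, ∀ (t : ℝ≥0) (i : Fin 2),
    (L ω t i : ℝ≥0∞) + departures (S i ω) (mu i) (L ω) i t = L ω 0 i + A i ω (Ioc 0 (t : ℝ))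

/-- The rescaled first coordinate `t ↦ x₁(c t) / a` of a càdlàg path. -/
def scaledFirst (x : ℝ≥0 → Fin 2 → ℕ) (hx : IsCadlag x) (c : ℝ≥0) (a : ℝ) : CadlagPath where
  toFun t := (x (c * t) 0 : ℝ) / a
  isCadlag t := by
    have hg : Continuous fun v : Fin 2 → ℕ => (v 0 : ℝ) / a := by fun_prop
    have hm : Continuous fun t : ℝ≥0 => c * t := by fun_prop
    constructor
    · have h1 : ContinuousWithinAt (fun t => x (c * t)) (Ici t) t :=
        ContinuousWithinAt.comp (t := Ici (c * t)) (hx (c * t)).1 hm.continuousWithinAt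
          fun s hs => mul_le_mul_right (mem_Ici.1 hs) c
      exact hg.continuousAt.comp_continuousWithinAt h1
    · rcases eq_or_ne c 0 with rfl | hc
      · exact ⟨(x 0 0 : ℝ) / a, by simpa using tendsto_const_nhds⟩
      · obtain ⟨l, hl⟩ := (hx (c * t)).2
        refine ⟨(l 0 : ℝ) / a, (hg.tendsto l).comp (hl.comp ?_)⟩
        refine tendsto_nhdsWithin_of_tendsto_nhds_of_eventually_within _
          (hm.continuousAt.mono_left nhdsWithin_le_nhds) ?_
        filter_upwards [self_mem_nhdsWithin] with s hs
        exact mul_lt_mul_of_pos_left hs (pos_iff_ne_zero.2 hc)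

/-- The equation which defines the limiting function: it is constant equal to `1` if `δ = 1`;
otherwise its values are in `(0, 1)`, where `1 / log` is locally integrable, and
`∫_δ^{h(t)} du / log u = - r t / (1 + α)²` for all `t`. -/
def IsFluidFunction (δ r α : ℝ) (h : ℝ≥0 → ℝ) : Prop :=
  (δ = 1 → ∀ t, h t = 1) ∧
    (δ ≠ 1 → ∀ t, h t ∈ Ioo (0 : ℝ) 1 ∧
      ∫ u in δ..h t, 1 / Real.log u = -(r * t) / (1 + α) ^ 2)

end

/-! ### Absolute deviation of Poisson counts -/

/-! Write `m = N^α`, `ℓ = log N`, `X = L₁ / m`. Over times of order `m ℓ` the second queue moves by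
`O(m ℓ)`, which is `o(N)` because `ρ₁ < 1/2` means `α < 1`; hence `log L₂ = ℓ + o(1)`. Since `log L₁
= α ℓ + log X + o(1)`, the share of the first queue is `α/(1+α) + log X / ((1+α)² ℓ) + o(1/ℓ)`
(`exists_abs_share_expansion_le`). The exponent `α` is the one for which `μ₁ α/(1+α) = λ₁`: the
leading term balances the arrivals, and what is left, on the time scale `m ℓ`, is `X' = -κ log X`
with `κ = μ₁/(1+α)²`. Separating variables gives the integral equation for `h`, solved in
`exists_fluidFunction`.

The noise is handled without martingales. Time is cut into blocks on which the service rate is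
nearly constant. The departures of a block are then sandwiched between counts of service points in
deterministic rectangles, whose heights run over a finite grid; `blockError` collects the deviations
of these counts from their means, and its expectation is bounded through Poisson variances.

The rest is deterministic. If the block errors add up to `o(m)`, then `X` at block ends is a
perturbed Euler scheme for `h`, and the Euler map is nonexpansive, so errors merely add
(`exists_tolerance`). `exists_failureSet` picks the block length and the grid so that the
exceptional events have vanishing probability, and `convergesInLaw_dirac` turns uniform closeness
off these events into convergence in law. -/

theorem hasSum_poisson_mul_natCast (r : ℝ≥0) :
    HasSum (fun n : ℕ => Real.exp (-r) * r ^ n / (n.factorial : ℝ) * n) r := by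
  have h := (hasSum_one_poissonMeasure r).mul_left (r : ℝ)
  have h2 := (hasSum_nat_add_iff (f := fun n : ℕ =>
    Real.exp (-r) * r ^ n / (n.factorial : ℝ) * n) 1 (g := (r : ℝ))).1 ?_
  · simpa using h2
  · rw [mul_one] at h
    refine h.congr_fun fun n => ?_
    rw [Nat.factorial_succ]
    push_cast
    have : (n.factorial : ℝ) ≠ 0 := by positivity
    field_simp
    ring

theorem hasSum_poisson_mul_descFactorial_two (r : ℝ≥0) :
    HasSum (fun n : ℕ => Real.exp (-r) * r ^ n / (n.factorial : ℝ) * (n * (n - 1)))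
      ((r : ℝ) ^ 2) := by
  have h := (hasSum_poisson_mul_natCast r).mul_left (r : ℝ)
  have h2 := (hasSum_nat_add_iff (f := fun n : ℕ =>
    Real.exp (-r) * r ^ n / (n.factorial : ℝ) * (n * (n - 1))) 1 (g := (r : ℝ) ^ 2)).1 ?_
  · simpa using h2
  · rw [← sq] at h
    refine h.congr_fun fun n => ?_
    rw [Nat.factorial_succ]
    push_cast
    have : (n.factorial : ℝ) ≠ 0 := by positivity
    field_simp
    ring

/-- Follows from `(n - r)² = n(n - 1) + (1 - 2r) n + r²` and the two factorial moments. -/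
theorem hasSum_poisson_mul_sub_sq (r : ℝ≥0) :
    HasSum (fun n : ℕ => Real.exp (-r) * r ^ n / (n.factorial : ℝ) * ((n : ℝ) - r) ^ 2) r := by
  have h := ((hasSum_poisson_mul_descFactorial_two r).add
    ((hasSum_poisson_mul_natCast r).mul_left (1 - 2 * (r : ℝ)))).add
    ((hasSum_one_poissonMeasure r).mul_left ((r : ℝ) ^ 2))
  convert h using 1
  · ext n; ring
  · ring

/-- AM-GM gives `|n - r| ≤ (n - r)² / (2√M) + √M / 2`, and the variance is `r ≤ M`. Using `M`
instead of `r` permits `r = 0` and one common bound for all grid levels. -/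
theorem lintegral_abs_sub_poissonMeasure_le {r : ℝ≥0} {M : ℝ} (hM : 0 < M) (hr : r ≤ M) :
    ∫⁻ n : ℕ, ENNReal.ofReal |(n : ℝ) - r| ∂(poissonMeasure r) ≤ ENNReal.ofReal (√M) := by
  have hq : 0 < √M := Real.sqrt_pos.2 hM
  have hs := ((hasSum_poisson_mul_sub_sq r).mul_left (1 / (2 * √M))).add
    ((hasSum_one_poissonMeasure r).mul_left (√M / 2))
  rw [lintegral_countable']
  calc ∑' n : ℕ, ENNReal.ofReal |(n : ℝ) - r| * poissonMeasure r {n}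
      ≤ ∑' n : ℕ, ENNReal.ofReal (1 / (2 * √M) *
          (Real.exp (-r) * r ^ n / (n.factorial : ℝ) * ((n : ℝ) - r) ^ 2) +
          √M / 2 * (Real.exp (-r) * r ^ n / (n.factorial : ℝ))) := by
        refine ENNReal.tsum_le_tsum fun n => ?_
        rw [poissonMeasure_singleton, ← ENNReal.ofReal_mul (abs_nonneg _)]
        refine ENNReal.ofReal_le_ofReal ?_
        have hp : 0 ≤ Real.exp (-r) * r ^ n / (n.factorial : ℝ) := by positivity
        have : |(n : ℝ) - r| ≤ 1 / (2 * √M) * ((n : ℝ) - r) ^ 2 + √M / 2 := by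
          rw [← sq_abs, div_mul_eq_mul_div, one_mul, div_add_div _ _ (by positivity) two_ne_zero,
            le_div_iff₀ (by positivity)]
          nlinarith [sq_nonneg (|(n : ℝ) - r| - √M)]
        nlinarith [mul_le_mul_of_nonneg_right this hp]
    _ = ENNReal.ofReal (1 / (2 * √M) * r + √M / 2 * 1) := by
        rw [← ENNReal.ofReal_tsum_of_nonneg _ hs.summable, hs.tsum_eq]
        intro n; positivity
    _ ≤ ENNReal.ofReal (√M) := by
        refine ENNReal.ofReal_le_ofReal ?_
        rw [div_mul_eq_mul_div, one_mul, mul_one, div_add_div _ _ (by positivity) two_ne_zero,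
            div_le_iff₀ (by positivity)]
        nlinarith [Real.mul_self_sqrt hM.le]

namespace IsPoissonProcess

variable {Ω E : Type*} [MeasurableSpace Ω] [MeasurableSpace E] {ξ : Ω → Measure E} {ν : Measure E}
  {P : Measure Ω}

theorem measurable_apply (h : IsPoissonProcess ξ ν P) {B : Set E} (hB : MeasurableSet B) :
    Measurable fun ω => ξ ω B :=
  (Measure.measurable_coe hB).comp h.measurable

theorem ae_lt_top (h : IsPoissonProcess ξ ν P) {B : Set E} (hB : MeasurableSet B)
    (hν : ν B ≠ ∞) : ∀ᵐ ω ∂P, ξ ω B < ∞ := by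
  have hm : AEMeasurable (fun ω => ξ ω B) P := (h.measurable_apply hB).aemeasurable
  refine ae_of_ae_map hm (p := fun x => x < ∞) ?_
  rw [h.law B hB hν, ae_map_iff (by fun_prop) measurableSet_Iio]
  exact ae_of_all _ fun n => ENNReal.natCast_lt_top n

/-- The absolute deviation of the number of points in `B` from its mean `a`. -/
theorem lintegral_abs_sub_le (h : IsPoissonProcess ξ ν P) {B : Set E} (hB : MeasurableSet B)
    {a M : ℝ} (ha : 0 ≤ a) (hν : ν B = ENNReal.ofReal a) (hM : 0 < M) (haM : a ≤ M) :
    ∫⁻ ω, ENNReal.ofReal |(ξ ω B).toReal - a| ∂P ≤ ENNReal.ofReal (√M) := by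
  have hf : Measurable fun x : ℝ≥0∞ => ENNReal.ofReal |x.toReal - a| := by fun_prop
  rw [← lintegral_map hf (h.measurable_apply hB), h.law B hB (by simp [hν]),
    lintegral_map hf (by fun_prop)]
  have hr : ((ν B).toNNReal : ℝ) = a := by
    rw [hν]; exact ENNReal.toReal_ofReal ha
  have := lintegral_abs_sub_poissonMeasure_le (r := (ν B).toNNReal) hM (by rw [hr]; exact haM)
  simpa [hr] using this

end IsPoissonProcess

/-! ### The limiting function -/

section LogIntegral

variable {δ : ℝ}

theorem continuousAt_one_div_log {x : ℝ} (hx : x ∈ Ioo (0 : ℝ) 1) :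
    ContinuousAt (fun u => 1 / Real.log u) x :=
  continuousAt_const.div (Real.continuousAt_log hx.1.ne') (Real.log_neg hx.1 hx.2).ne

theorem intervalIntegrable_one_div_log {x y : ℝ} (hx : x ∈ Ioo (0 : ℝ) 1) (hy : y ∈ Ioo (0 : ℝ) 1) :
    IntervalIntegrable (fun u => 1 / Real.log u) volume x y :=
  ContinuousOn.intervalIntegrable fun _ hz =>
    (continuousAt_one_div_log (ordConnected_Ioo.uIcc_subset hx hy hz)).continuousWithinAt

theorem hasDerivAt_integral_one_div_log (hδ : δ ∈ Ioo (0 : ℝ) 1) {x : ℝ} (hx : x ∈ Ioo (0 : ℝ) 1) :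
    HasDerivAt (fun y => ∫ u in δ..y, 1 / Real.log u) (1 / Real.log x) x := by
  refine intervalIntegral.integral_hasDerivAt_right (intervalIntegrable_one_div_log hδ hx) ?_
    (continuousAt_one_div_log hx)
  exact (Measurable.stronglyMeasurable (by fun_prop)).stronglyMeasurableAtFilter

/-- Mean value theorem for the primitive of `1 / log`, solved for `y - x`. It yields both the
injectivity of the primitive and the differential form of the integral equation. -/
theorem exists_sub_eq_log_mul_integral (hδ : δ ∈ Ioo (0 : ℝ) 1) {x y : ℝ} (hx : x ∈ Ioo (0 : ℝ) 1)
    (hy : y ∈ Ioo (0 : ℝ) 1) :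
    ∃ ξ ∈ uIcc x y, y - x = Real.log ξ *
      ((∫ u in δ..y, 1 / Real.log u) - ∫ u in δ..x, 1 / Real.log u) := by
  wlog hxy : x < y generalizing x y
  · rcases (not_lt.1 hxy).eq_or_lt with rfl | h
    · exact ⟨y, by simp, by simp⟩
    · obtain ⟨ξ, h1, h2⟩ := this hy hx h
      exact ⟨ξ, by rwa [uIcc_comm], by linarith⟩
  have hsub : Icc x y ⊆ Ioo 0 1 := fun z hz => ⟨hx.1.trans_le hz.1, hz.2.trans_lt hy.2⟩
  obtain ⟨ξ, hξ, h⟩ := exists_hasDerivAt_eq_slope (fun y => ∫ u in δ..y, 1 / Real.log u)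
    (fun x => 1 / Real.log x) hxy
    (fun z hz => (hasDerivAt_integral_one_div_log hδ (hsub hz)).continuousAt.continuousWithinAt)
    (fun z hz => hasDerivAt_integral_one_div_log hδ (hsub (Ioo_subset_Icc_self hz)))
  have hξ' := hsub (Ioo_subset_Icc_self hξ)
  refine ⟨ξ, Icc_subset_uIcc (Ioo_subset_Icc_self hξ), ?_⟩
  have hl : Real.log ξ ≠ 0 := (Real.log_neg hξ'.1 hξ'.2).ne
  have hd : y - x ≠ 0 := by linarith
  field_simp at h
  linarith

theorem integral_one_div_log_injOn (hδ : δ ∈ Ioo (0 : ℝ) 1) :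
    InjOn (fun y => ∫ u in δ..y, 1 / Real.log u) (Ioo 0 1) := by
  intro x hx y hy h
  obtain ⟨ξ, -, h2⟩ := exists_sub_eq_log_mul_integral hδ hx hy
  simp only at h
  rw [h, sub_self, mul_zero] at h2
  linarith

/-- On `[δ, 1)` one has `-log z ≤ (1 - z)/z ≤ (1 - z)/δ`, so the integrand is at most `-δ/(1 - z)`.
Hence the primitive diverges to `-∞` at `1`: the limiting function exists for all times and never
reaches `1`. -/
theorem integral_one_div_log_le (hδ : δ ∈ Ioo (0 : ℝ) 1) {x : ℝ} (hx : x ∈ Ico δ 1) :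
    ∫ u in δ..x, 1 / Real.log u ≤ δ * (Real.log (1 - x) - Real.log (1 - δ)) := by
  have hsub : Icc δ x ⊆ Ioo 0 1 := fun z hz => ⟨hδ.1.trans_le hz.1, hz.2.trans_lt hx.2⟩
  have hd : ∀ z ∈ Icc δ x, HasDerivAt (fun z => δ * (Real.log (1 - z) - Real.log (1 - δ)) -
      ∫ u in δ..z, 1 / Real.log u) (δ * ((-1) / (1 - z)) - 1 / Real.log z) z := by
    intro z hz
    have h1 : HasDerivAt (fun z => Real.log (1 - z)) ((-1) / (1 - z)) z :=
      ((hasDerivAt_id z).const_sub 1).log (by have := (hsub hz).2; simp; linarith)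
    exact ((h1.sub_const _).const_mul δ).sub (hasDerivAt_integral_one_div_log hδ (hsub hz))
  have hmono : MonotoneOn (fun z => δ * (Real.log (1 - z) - Real.log (1 - δ)) -
      ∫ u in δ..z, 1 / Real.log u) (Icc δ x) := by
    refine monotoneOn_of_deriv_nonneg (convex_Icc _ _)
      (fun z hz => (hd z hz).continuousAt.continuousWithinAt) ?_ ?_
    · intro z hz
      exact (hd z (interior_subset hz)).differentiableAt.differentiableWithinAt
    · intro z hz
      have hz' := interior_subset hz
      rw [(hd z hz').deriv]
      have h01 := hsub hz'
      have hl := Real.log_neg h01.1 h01.2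
      have h1z : 0 < 1 - z := by linarith [h01.2]
      have hlog : 1 - z⁻¹ ≤ Real.log z := Real.one_sub_inv_le_log_of_pos h01.1
      have : -Real.log z * δ ≤ 1 - z := by
        have h3 : -Real.log z * z ≤ 1 - z := by
          have := mul_le_mul_of_nonneg_right hlog h01.1.le
          rw [sub_mul, inv_mul_cancel₀ h01.1.ne'] at this
          linarith
        nlinarith [hz'.1]
      have e : δ * ((-1) / (1 - z)) - 1 / Real.log z =
          (1 - z - (-Real.log z * δ)) / ((1 - z) * -Real.log z) := by
        have := hl.ne
        field_simp
        ring
      rw [e]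
      exact div_nonneg (by linarith) (mul_nonneg h1z.le (by linarith))
  have := hmono (left_mem_Icc.2 hx.1) (right_mem_Icc.2 hx.1) hx.1
  simp only [sub_self, mul_zero, intervalIntegral.integral_same] at this
  linarith

theorem exists_integral_one_div_log_eq (hδ : δ ∈ Ioo (0 : ℝ) 1) {c : ℝ} (hc : c ≤ 0) :
    ∃ x ∈ Ico δ 1, ∫ u in δ..x, 1 / Real.log u = c := by
  have h1 : 0 < 1 - δ := by linarith [hδ.2]
  -- Chosen so that the bound of `integral_one_div_log_le` at `y` is exactly `c`; the intermediate
  -- value theorem then applies on `[δ, y]`.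
  set y := 1 - (1 - δ) * Real.exp (c / δ) with hy
  have he : Real.exp (c / δ) ≤ 1 := Real.exp_le_one_iff.2 (div_nonpos_of_nonpos_of_nonneg hc hδ.1.le)
  have he0 := Real.exp_pos (c / δ)
  have hy1 : y ∈ Ico δ 1 := ⟨by nlinarith, by nlinarith⟩
  have hle := integral_one_div_log_le hδ hy1
  have : (1 : ℝ) - y = (1 - δ) * Real.exp (c / δ) := by rw [hy]; ring
  rw [this, Real.log_mul h1.ne' he0.ne', Real.log_exp, add_sub_cancel_left,
    mul_div_cancel₀ _ hδ.1.ne'] at hle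
  have hcont : ContinuousOn (fun y => ∫ u in δ..y, 1 / Real.log u) (Icc δ y) := fun z hz =>
    (hasDerivAt_integral_one_div_log hδ
      ⟨hδ.1.trans_le hz.1, hz.2.trans_lt hy1.2⟩).continuousAt.continuousWithinAt
  obtain ⟨x, hx, hxc⟩ := intermediate_value_Icc' hy1.1 hcont ⟨hle, by simpa using hc⟩
  exact ⟨x, ⟨hx.1, hx.2.trans_lt hy1.2⟩, hxc⟩

end LogIntegral

theorem abs_log_sub_log_le {a x y : ℝ} (ha : 0 < a) (hx : a ≤ x) (hy : a ≤ y) :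
    |Real.log x - Real.log y| ≤ |x - y| / a := by
  wlog hxy : y ≤ x generalizing x y
  · rw [abs_sub_comm, abs_sub_comm x]
    exact this hy hx (not_le.1 hxy).le
  have hy0 := ha.trans_le hy
  have hx0 := ha.trans_le hx
  rw [abs_of_nonneg (by linarith [Real.log_le_log hy0 hxy]), abs_of_nonneg (by linarith),
    ← Real.log_div hx0.ne' hy0.ne']
  calc Real.log (x / y) ≤ x / y - 1 := Real.log_le_sub_one_of_pos (by positivity)
    _ = (x - y) / y := by field_simp
    _ ≤ (x - y) / a := by gcongr

/-- The limiting function exists, is unique, and satisfies `h' = - κ log h` in the form of a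
first-order expansion with a uniform remainder. -/
theorem exists_fluidFunction {δ r α : ℝ} (hδ : δ ∈ Ioc (0 : ℝ) 1) (hr : 0 < r) (hα : 0 < α) :
    ∃ (h : ℝ≥0 → ℝ) (C : ℝ), 0 ≤ C ∧ (∀ g, IsFluidFunction δ r α g ↔ g = h) ∧ h 0 = δ ∧
      (∀ t, h t ∈ Icc δ 1) ∧ ∀ t s : ℝ≥0, t ≤ s → |h s - h t| ≤ C * (s - t) ∧
        |h s - h t + r / (1 + α) ^ 2 * (s - t) * Real.log (h t)| ≤ C * ((s : ℝ) - t) ^ 2 := by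
  rcases hδ.2.eq_or_lt with h1 | h1
  · refine ⟨fun _ => 1, 0, le_rfl, fun g => ?_, h1.symm, fun t => ⟨hδ.2, le_rfl⟩, ?_⟩
    · simp [IsFluidFunction, h1, funext_iff]
    · intro t s _; simp
  have hδ' : δ ∈ Ioo (0 : ℝ) 1 := ⟨hδ.1, h1⟩
  set κ := r / (1 + α) ^ 2 with hκ
  have hκ0 : 0 < κ := by positivity
  have hex : ∀ t : ℝ≥0, ∃ x ∈ Ico δ 1, ∫ u in δ..x, 1 / Real.log u = -(r * t) / (1 + α) ^ 2 :=
    fun t => exists_integral_one_div_log_eq hδ'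
      (div_nonpos_of_nonpos_of_nonneg (by have := t.2; simp; positivity) (by positivity))
  choose h hmem hint using hex
  have hmem' : ∀ t, h t ∈ Ioo (0 : ℝ) 1 := fun t => ⟨hδ.1.trans_le (hmem t).1, (hmem t).2⟩
  set Λ := -Real.log δ with hΛ
  have hΛ0 : 0 ≤ Λ := by have := Real.log_neg hδ.1 h1; linarith
  have key : ∀ t s : ℝ≥0, ∃ ξ ∈ uIcc (h t) (h s), h s - h t = -(κ * (s - t) * Real.log ξ) := by
    intro t s
    obtain ⟨ξ, h1, h2⟩ := exists_sub_eq_log_mul_integral hδ' (hmem' t) (hmem' s)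
    refine ⟨ξ, h1, h2.trans ?_⟩
    rw [hint, hint, hκ]
    ring
  have hlip : ∀ t s : ℝ≥0, t ≤ s → |h s - h t| ≤ κ * Λ * (s - t) := by
    intro t s hts
    have hts' : (0 : ℝ) ≤ s - t := sub_nonneg.2 hts
    obtain ⟨ξ, h1, h2⟩ := key t s
    have h3 : ξ ∈ Ico δ 1 := ordConnected_Ico.uIcc_subset (hmem t) (hmem s) h1
    have h4 := Real.log_le_log hδ.1 h3.1
    have h5 := Real.log_neg (hδ.1.trans_le h3.1) h3.2
    rw [h2, abs_neg, abs_mul, abs_of_nonneg (by positivity), abs_of_neg h5]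
    nlinarith [mul_le_mul_of_nonneg_left (show -Real.log ξ ≤ Λ by linarith)
      (show 0 ≤ κ * ((s : ℝ) - t) by positivity)]
  have h0 : h 0 = δ := by
    refine integral_one_div_log_injOn hδ' (hmem' 0) hδ' ?_
    simp only [hint, intervalIntegral.integral_same]
    simp
  -- `κ * Λ` is the Lipschitz constant of `h`; the second summand is the quadratic remainder, using
  -- that `log` is `1/δ`-Lipschitz on `[δ, 1]`.
  refine ⟨h, κ * Λ + κ * (κ * Λ) / δ, by have := hδ.1; positivity, fun g => ⟨fun hg => ?_, ?_⟩, h0,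
    fun t => ⟨(hmem t).1, (hmem t).2.le⟩, fun t s hts => ?_⟩
  · funext t
    have := hg.2 h1.ne t
    exact integral_one_div_log_injOn hδ' this.1 (hmem' t) (by simp only [this.2, hint])
  · rintro rfl
    exact ⟨fun h => absurd h h1.ne, fun _ t => ⟨hmem' t, hint t⟩⟩
  · have hts' : (0 : ℝ) ≤ s - t := sub_nonneg.2 hts
    have hδ0 := hδ.1
    have hq : 0 ≤ κ * (κ * Λ) / δ := by positivity
    refine ⟨(hlip t s hts).trans ?_, ?_⟩
    · nlinarith
    · obtain ⟨ξ, h1, h2⟩ := key t s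
      have h3 : ξ ∈ Ico δ 1 := ordConnected_Ico.uIcc_subset (hmem t) (hmem s) h1
      have e : h s - h t + κ * (s - t) * Real.log (h t) =
          κ * (s - t) * (Real.log (h t) - Real.log ξ) := by rw [h2]; ring
      rw [e, abs_mul, abs_of_nonneg (by positivity)]
      have h4 := abs_log_sub_log_le hδ.1 (hmem t).1 h3.1
      have h5 : |h t - ξ| ≤ κ * Λ * (s - t) := by
        refine le_trans ?_ (hlip t s hts)
        rw [abs_sub_comm]
        exact abs_sub_left_of_mem_uIcc h1
      calc κ * (s - t) * |Real.log (h t) - Real.log ξ|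
          ≤ κ * (s - t) * (κ * Λ * (s - t) / δ) := by gcongr; exact h4.trans (by gcongr)
        _ = κ * (κ * Λ) / δ * ((s : ℝ) - t) ^ 2 := by ring
        _ ≤ _ := by gcongr; nlinarith [mul_nonneg hκ0.le hΛ0]

/-! ### Increments of a solution over a block of time -/

/-- In a discrete space a left limit is eventually attained, so the rate at `s-` is a rate taken at
some time of the block. -/
theorem IsCadlag.exists_leftLim_eq {β : Type*} [TopologicalSpace β] [DiscreteTopology β]
    {x : ℝ≥0 → β} (hx : IsCadlag x) {a s : ℝ≥0} (h : a < s) :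
    ∃ u ∈ Ico a s, Function.leftLim x s = x u := by
  obtain ⟨l, hl⟩ := (hx s).2
  have hne : (𝓝[<] s).NeBot := nhdsLT_neBot_of_exists_lt ⟨a, h⟩
  have h1 : ∀ᶠ u in 𝓝[<] s, x u = l := by
    rw [nhds_discrete, tendsto_pure] at hl; exact hl
  obtain ⟨u, hu, hu'⟩ := (h1.and (Ico_mem_nhdsLT h)).exists
  exact ⟨u, hu', by rw [leftLim_eq_of_tendsto hl, hu]⟩

theorem serviceShare_nonneg (x : Fin 2 → ℕ) (i : Fin 2) : 0 ≤ serviceShare x i :=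
  div_nonneg (Real.log_nonneg (by simp))
    (add_nonneg (Real.log_nonneg (by simp)) (Real.log_nonneg (by simp)))

theorem serviceShare_le_one (x : Fin 2 → ℕ) (i : Fin 2) : serviceShare x i ≤ 1 := by
  have h : ∀ j, 0 ≤ Real.log (1 + x j) := fun j => Real.log_nonneg (by simp)
  refine div_le_one_of_le₀ ?_ (add_nonneg (h 0) (h 1))
  fin_cases i
  · simpa using h 1
  · simpa using h 0

/-- The path properties of a solution of the queueing equations that hold almost surely. -/
structure IsQueuePath (mu : Fin 2 → ℝ) (A : Fin 2 → Measure ℝ) (S : Fin 2 → Measure (ℝ × ℝ))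
    (x : ℝ≥0 → Fin 2 → ℕ) : Prop where
  cadlag : IsCadlag x
  arrivals_lt_top : ∀ i (t : ℝ≥0), A i (Ioc 0 (t : ℝ)) < ∞
  services_lt_top : ∀ i (t : ℝ≥0), S i (Icc 0 (mu i) ×ˢ Ioc 0 (t : ℝ)) < ∞
  equation : ∀ (t : ℝ≥0) i,
    (x t i : ℝ≥0∞) + departures (S i) (mu i) x i t = x 0 i + A i (Ioc 0 (t : ℝ))

theorem arrivalIntensity_Ioc {l a b : ℝ} (hl : 0 ≤ l) (ha : 0 ≤ a) :
    (ENNReal.ofReal l • volume.restrict (Ici (0 : ℝ))) (Ioc a b) =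
      ENNReal.ofReal (l * (b - a)) := by
  rw [Measure.smul_apply, Measure.restrict_apply measurableSet_Ioc,
    inter_eq_left.2 (show Ioc a b ⊆ Ici 0 from fun y hy => ha.trans hy.1.le), Real.volume_Ioc, smul_eq_mul,
    ENNReal.ofReal_mul hl]

theorem serviceIntensity_Icc_prod_Ioc {w a b : ℝ} (hw : 0 ≤ w) (ha : 0 ≤ a) :
    (volume.restrict (Ici (0 : ℝ) ×ˢ Ici (0 : ℝ))) (Icc 0 w ×ˢ Ioc a b) =
      ENNReal.ofReal (w * (b - a)) := by
  rw [Measure.restrict_apply (measurableSet_Icc.prod measurableSet_Ioc),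
    inter_eq_left.2 (show Icc 0 w ×ˢ Ioc a b ⊆ Ici 0 ×ˢ Ici 0 from
      fun y hy => ⟨hy.1.1, ha.trans hy.2.1.le⟩), Measure.volume_eq_prod,
    Measure.prod_prod, Real.volume_Icc, Real.volume_Ioc, sub_zero, ENNReal.ofReal_mul hw]

theorem IsQueueSolution.ae_isQueuePath {Ω : Type*} [MeasurableSpace Ω] {lam mu : Fin 2 → ℝ}
    {P : Measure Ω} {A : Fin 2 → Ω → Measure ℝ} {S : Fin 2 → Ω → Measure (ℝ × ℝ)}
    {L : Ω → ℝ≥0 → Fin 2 → ℕ} (hL : IsQueueSolution lam mu P A S L) (hlam : ∀ i, 0 < lam i)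
    (hmu : ∀ i, 0 < mu i) :
    ∀ᵐ ω ∂P, IsQueuePath mu (fun i => A i ω) (fun i => S i ω) (L ω) := by
  have hA : ∀ᵐ ω ∂P, ∀ i, ∀ n : ℕ, A i ω (Ioc 0 (n : ℝ)) < ∞ := by
    refine ae_all_iff.2 fun i => ae_all_iff.2 fun n =>
      (hL.arrivals i).ae_lt_top measurableSet_Ioc ?_
    rw [arrivalIntensity_Ioc (hlam i).le le_rfl]
    exact ENNReal.ofReal_ne_top
  have hS : ∀ᵐ ω ∂P, ∀ i, ∀ n : ℕ, S i ω (Icc 0 (mu i) ×ˢ Ioc 0 (n : ℝ)) < ∞ := by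
    refine ae_all_iff.2 fun i => ae_all_iff.2 fun n =>
      (hL.services i).ae_lt_top (measurableSet_Icc.prod measurableSet_Ioc) ?_
    rw [serviceIntensity_Icc_prod_Ioc (hmu i).le le_rfl]
    exact ENNReal.ofReal_ne_top
  filter_upwards [hA, hS, hL.equation] with ω h1 h2 h3
  have hle : ∀ t : ℝ≥0, Ioc (0 : ℝ) t ⊆ Ioc 0 (⌈(t : ℝ)⌉₊ : ℝ) := fun t =>
    Ioc_subset_Ioc_right (Nat.le_ceil _)
  exact ⟨hL.cadlag ω, fun i t => (measure_mono (hle t)).trans_lt (h1 i _),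
    fun i t => (measure_mono (prod_mono le_rfl (hle t))).trans_lt (h2 i _), h3⟩

/-- The total deviation, on the block `(a, b]`, of the number of arrivals and of the numbers of
service points with marks below the levels `j * r / J`, `j ≤ J`, from their means. -/
noncomputable def blockError (l r : ℝ) (A : Measure ℝ) (S : Measure (ℝ × ℝ)) (J : ℕ) (a b : ℝ) :
    ℝ :=
  |(A (Ioc a b)).toReal - l * (b - a)| + ∑ j ∈ Finset.range (J + 1),
    |(S (Icc 0 (j * r / J) ×ˢ Ioc a b)).toReal - j * r / J * (b - a)|

section BlockError

variable {l r a b : ℝ} {A : Measure ℝ} {S : Measure (ℝ × ℝ)} {J : ℕ}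

theorem abs_services_sub_le_sum {j : ℕ} (hj : j ≤ J) :
    |(S (Icc 0 (j * r / J) ×ˢ Ioc a b)).toReal - j * r / J * (b - a)| ≤
      ∑ j ∈ Finset.range (J + 1),
        |(S (Icc 0 (j * r / J) ×ˢ Ioc a b)).toReal - j * r / J * (b - a)| :=
  Finset.single_le_sum
    (f := fun j : ℕ => |(S (Icc 0 (j * r / J) ×ˢ Ioc a b)).toReal - j * r / J * (b - a)|)
    (fun _ _ => abs_nonneg _) (Finset.mem_range.2 (Nat.lt_succ_of_le hj))

theorem blockError_nonneg : 0 ≤ blockError l r A S J a b :=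
  add_nonneg (abs_nonneg _) (Finset.sum_nonneg fun _ _ => abs_nonneg _)

/-- The count is monotone in the height `w`; rounding `w` down or up to the grid changes the mean by
at most `r / J * (b - a)`. The bound is uniform in `w`, so it may be used with heights that depend
on the path. -/
theorem abs_services_sub_le (hr : 0 < r) (hJ : 0 < J) (hab : a ≤ b)
    (hS : S (Icc 0 r ×ˢ Ioc a b) < ∞) {w : ℝ} (hw : w ∈ Icc 0 r) :
    |(S (Icc 0 w ×ˢ Ioc a b)).toReal - w * (b - a)| ≤
      ∑ j ∈ Finset.range (J + 1),
        |(S (Icc 0 (j * r / J) ×ˢ Ioc a b)).toReal - j * r / J * (b - a)| + r / J * (b - a) := by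
  have hJ' : (0 : ℝ) < J := by exact_mod_cast hJ
  have hab' : 0 ≤ b - a := by linarith
  have hmono : ∀ {u v : ℝ}, u ≤ v → v ≤ r →
      (S (Icc 0 u ×ˢ Ioc a b)).toReal ≤ (S (Icc 0 v ×ˢ Ioc a b)).toReal := by
    intro u v huv hv
    refine ENNReal.toReal_mono (ne_top_of_le_ne_top hS.ne (measure_mono ?_)) (measure_mono ?_)
    · exact prod_mono (Icc_subset_Icc_right hv) le_rfl
    · exact prod_mono (Icc_subset_Icc_right huv) le_rfl
  have hq0 : 0 ≤ w * J / r := div_nonneg (mul_nonneg hw.1 hJ'.le) hr.le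
  have hqJ : w * J / r ≤ J := by rw [div_le_iff₀ hr]; nlinarith [hw.2]
  have hwq : w * J / r * r / J = w := by field_simp
  rw [abs_le]
  constructor
  · set j := ⌊w * J / r⌋₊
    have hj : (j : ℝ) ≤ w * J / r := Nat.floor_le hq0
    have hj' : w * J / r ≤ j + 1 := (Nat.lt_floor_add_one _).le
    have hjJ : j ≤ J := by exact_mod_cast hj.trans hqJ
    have h1 : j * r / J ≤ w := by rw [← hwq]; gcongr
    have h2 : w ≤ j * r / J + r / J := by
      rw [← add_div, ← add_one_mul]; nth_rw 1 [← hwq]; gcongr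
    have h3 := abs_le.1 (abs_services_sub_le_sum (r := r) (a := a) (b := b) (S := S) hjJ)
    have h4 := hmono h1 hw.2
    have h5 := mul_le_mul_of_nonneg_right h2 hab'
    linarith [h3.1]
  · set j := ⌈w * J / r⌉₊
    have hj : w * J / r ≤ j := Nat.le_ceil _
    have hj' : (j : ℝ) ≤ w * J / r + 1 := (Nat.ceil_lt_add_one hq0).le
    have hjJ : j ≤ J := Nat.ceil_le.2 hqJ
    have h1 : w ≤ j * r / J := by nth_rw 1 [← hwq]; gcongr
    have h2 : j * r / J ≤ w + r / J := by
      nth_rw 1 [← hwq]; rw [← add_div, ← add_one_mul]; gcongr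
    have hjr : j * r / J ≤ r := by
      rw [div_le_iff₀ hJ', mul_comm]; gcongr
    have h3 := abs_le.1 (abs_services_sub_le_sum (r := r) (a := a) (b := b) (S := S) hjJ)
    have h4 := hmono h1 hjr
    have h5 := mul_le_mul_of_nonneg_right h2 hab'
    linarith [h3.2]

end BlockError

/-! ### Departures sandwiched between rectangles of service points -/

namespace IsQueuePath

variable {mu : Fin 2 → ℝ} {A : Fin 2 → Measure ℝ} {S : Fin 2 → Measure (ℝ × ℝ)}
  {x : ℝ≥0 → Fin 2 → ℕ}

theorem arrivals_Ioc_lt_top (hx : IsQueuePath mu A S x) (i : Fin 2) (a b : ℝ≥0) :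
    A i (Ioc (a : ℝ) b) < ∞ :=
  (measure_mono (Ioc_subset_Ioc_left a.2)).trans_lt (hx.arrivals_lt_top i b)

theorem services_Ioc_lt_top (hx : IsQueuePath mu A S x) (i : Fin 2) (a b : ℝ≥0) :
    S i (Icc 0 (mu i) ×ˢ Ioc (a : ℝ) b) < ∞ :=
  (measure_mono (prod_mono le_rfl (Ioc_subset_Ioc_left a.2))).trans_lt (hx.services_lt_top i b)

/-- The service points which give the departures of class `i` during `(a, b]`. -/
def departureSet (mu : Fin 2 → ℝ) (x : ℝ≥0 → Fin 2 → ℕ) (i : Fin 2) (a b : ℝ≥0) : Set (ℝ × ℝ) :=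
  {p | (a : ℝ) < p.2 ∧ p.2 ≤ b ∧ 0 ≤ p.1 ∧
    p.1 ≤ mu i * serviceShare (Function.leftLim x p.2.toNNReal) i}

theorem exists_serviceShare_leftLim (hx : IsQueuePath mu A S x) (i : Fin 2) {a b : ℝ≥0} {t : ℝ}
    (ht : t ∈ Ioc (a : ℝ) b) :
    ∃ s ∈ Icc a b, serviceShare (Function.leftLim x t.toNNReal) i = serviceShare (x s) i := by
  have h1 : a < t.toNNReal := Real.lt_toNNReal_iff_coe_lt.2 ht.1
  obtain ⟨s, hs, h⟩ := hx.cadlag.exists_leftLim_eq h1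
  exact ⟨s, ⟨hs.1, hs.2.le.trans (Real.toNNReal_le_iff_le_coe.2 ht.2)⟩, by rw [h]⟩

theorem departureSet_subset (hx : IsQueuePath mu A S x) {i : Fin 2} {a b : ℝ≥0} {w : ℝ}
    (hw : ∀ s ∈ Icc a b, mu i * serviceShare (x s) i ≤ w) :
    departureSet mu x i a b ⊆ Icc 0 w ×ˢ Ioc (a : ℝ) b := by
  rintro ⟨y, t⟩ ⟨h1, h2, h3, h4⟩
  obtain ⟨s, hs, h⟩ := hx.exists_serviceShare_leftLim i ⟨h1, h2⟩
  simp only at h4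
  rw [h] at h4
  exact ⟨⟨h3, h4.trans (hw s hs)⟩, h1, h2⟩

theorem subset_departureSet (hx : IsQueuePath mu A S x) {i : Fin 2} {a b : ℝ≥0} {w : ℝ}
    (hw : ∀ s ∈ Icc a b, w ≤ mu i * serviceShare (x s) i) :
    Icc 0 w ×ˢ Ioc (a : ℝ) b ⊆ departureSet mu x i a b := by
  rintro ⟨y, t⟩ ⟨⟨h3, h4⟩, h1, h2⟩
  obtain ⟨s, hs, h⟩ := hx.exists_serviceShare_leftLim i ⟨h1, h2⟩
  refine ⟨h1, h2, h3, ?_⟩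
  simp only
  rw [h]
  exact h4.trans (hw s hs)

theorem departureSet_lt_top (hx : IsQueuePath mu A S x) (hmu : ∀ i, 0 < mu i) (i : Fin 2)
    (a b : ℝ≥0) : S i (departureSet mu x i a b) < ∞ :=
  (measure_mono (hx.departureSet_subset fun _ _ =>
    mul_le_of_le_one_right (hmu i).le (serviceShare_le_one _ _))).trans_lt
      (hx.services_Ioc_lt_top i a b)

theorem increment_eq (hx : IsQueuePath mu A S x) (hmu : ∀ i, 0 < mu i) (i : Fin 2) {a b : ℝ≥0}
    (hab : a ≤ b) :
    (x b i : ℝ) = x a i + (A i (Ioc (a : ℝ) b)).toReal -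
      (S i (departureSet mu x i a b)).toReal := by
  have hdep : ∀ t, departures (S i) (mu i) x i t = S i (departureSet mu x i 0 t) := fun t => rfl
  have hsplit : S i (departureSet mu x i 0 b) =
      S i (departureSet mu x i 0 a) + S i (departureSet mu x i a b) := by
    -- Cutting along a measurable half-plane gives additivity without any measurability of the
    -- departure sets.
    have hm : MeasurableSet {p : ℝ × ℝ | p.2 ≤ a} := measurableSet_le measurable_snd (by fun_prop)
    rw [← measure_inter_add_sdiff _ hm]
    congr 2
    · ext p
      simp only [departureSet, mem_inter_iff, mem_ofPred_eq]
      have : (a : ℝ) ≤ b := hab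
      constructor
      · rintro ⟨⟨h1, h2, h3⟩, h4⟩; exact ⟨h1, h4, h3⟩
      · rintro ⟨h1, h2, h3⟩; exact ⟨⟨h1, h2.trans this, h3⟩, h2⟩
    · ext p
      simp only [departureSet, Set.mem_sdiff, mem_ofPred_eq, not_le]
      have : (0 : ℝ) ≤ a := a.2
      constructor
      · rintro ⟨⟨h1, h3⟩, h4⟩; exact ⟨h4, h3⟩
      · rintro ⟨h1, h3⟩; exact ⟨⟨this.trans_lt h1, h3⟩, h1⟩
  have hA : A i (Ioc 0 (b : ℝ)) = A i (Ioc 0 (a : ℝ)) + A i (Ioc (a : ℝ) b) := by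
    rw [← measure_union (Ioc_disjoint_Ioc_of_le le_rfl) measurableSet_Ioc,
      Ioc_union_Ioc_eq_Ioc a.coe_nonneg (NNReal.coe_le_coe.2 hab)]
  have toR : ∀ t, (x t i : ℝ) + (S i (departureSet mu x i 0 t)).toReal =
      x 0 i + (A i (Ioc 0 (t : ℝ))).toReal := by
    intro t
    have h := congrArg ENNReal.toReal (hx.equation t i)
    rw [hdep, ENNReal.toReal_add (ENNReal.natCast_ne_top _) (hx.departureSet_lt_top hmu i 0 t).ne,
      ENNReal.toReal_add (ENNReal.natCast_ne_top _) (hx.arrivals_lt_top i t).ne] at h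
    simpa using h
  have h1 := toR a
  have h2 := toR b
  rw [hsplit, hA, ENNReal.toReal_add (hx.departureSet_lt_top hmu i 0 a).ne
    (hx.departureSet_lt_top hmu i a b).ne, ENNReal.toReal_add (hx.arrivals_lt_top i a).ne
    (hx.arrivals_Ioc_lt_top i a b).ne] at h2
  linarith

/-- Over a block on which the service rate is almost constant, the increment is close to the one
of the fluid approximation. -/
theorem abs_increment_sub_le (hx : IsQueuePath mu A S x) (hmu : ∀ i, 0 < mu i) {i : Fin 2}
    {a b : ℝ≥0} (hab : a ≤ b) {J : ℕ} (hJ : 0 < J) {l w ε : ℝ}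
    (hw : ∀ s ∈ Icc a b, |mu i * serviceShare (x s) i - w| ≤ ε) :
    |(x b i : ℝ) - x a i - (l - w) * (b - a)| ≤
      blockError l (mu i) (A i) (S i) J a b + (ε + mu i / J) * (b - a) := by
  have hab' : (0 : ℝ) ≤ b - a := sub_nonneg.2 hab
  have hfin := hx.services_Ioc_lt_top i a b
  have hr := hmu i
  have hle : ∀ s, mu i * serviceShare (x s) i ≤ mu i := fun _ =>
    mul_le_of_le_one_right hr.le (serviceShare_le_one _ _)
  have hge : ∀ s, 0 ≤ mu i * serviceShare (x s) i := fun _ =>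
    mul_nonneg hr.le (serviceShare_nonneg _ _)
  have hwa := abs_le.1 (hw a (left_mem_Icc.2 hab))
  -- The levels `w ± ε` are truncated to `[0, mu i]`, the range covered by the grid; the rates lie
  -- there anyway.
  have hup : min (w + ε) (mu i) ∈ Icc 0 (mu i) :=
    ⟨le_min (by linarith [hge a]) hr.le, min_le_right _ _⟩
  have hlo : max (w - ε) 0 ∈ Icc 0 (mu i) :=
    ⟨le_max_right _ _, max_le (by linarith [hle a]) hr.le⟩
  have h1 : (S i (departureSet mu x i a b)).toReal ≤
      (S i (Icc 0 (min (w + ε) (mu i)) ×ˢ Ioc (a : ℝ) b)).toReal := by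
    refine ENNReal.toReal_mono (ne_top_of_le_ne_top hfin.ne (measure_mono ?_))
      (measure_mono (hx.departureSet_subset fun s hs => ?_))
    · exact prod_mono (Icc_subset_Icc_right hup.2) le_rfl
    · exact le_min (by linarith [(abs_le.1 (hw s hs)).2]) (hle s)
  have h2 : (S i (Icc 0 (max (w - ε) 0) ×ˢ Ioc (a : ℝ) b)).toReal ≤
      (S i (departureSet mu x i a b)).toReal := by
    refine ENNReal.toReal_mono (hx.departureSet_lt_top hmu i a b).ne
      (measure_mono (hx.subset_departureSet fun s hs => ?_))
    exact max_le (by linarith [(abs_le.1 (hw s hs)).1]) (hge s)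
  have h3 := (abs_le.1 (abs_services_sub_le hr hJ (NNReal.coe_le_coe.2 hab) hfin hup)).2
  have h4 := (abs_le.1 (abs_services_sub_le hr hJ (NNReal.coe_le_coe.2 hab) hfin hlo)).1
  have h5 := mul_le_mul_of_nonneg_right (min_le_left (w + ε) (mu i)) hab'
  have h6 := mul_le_mul_of_nonneg_right (le_max_left (w - ε) 0) hab'
  have h7 := abs_le.1 (le_refl |(A i (Ioc (a : ℝ) b)).toReal - l * (b - a)|)
  rw [hx.increment_eq hmu i hab, blockError, abs_le]
  constructor <;> linarith [h7.1, h7.2]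

/-- A crude bound for the oscillation over a block. -/
theorem abs_sub_le (hx : IsQueuePath mu A S x) (hmu : ∀ i, 0 < mu i) {i : Fin 2}
    {a b : ℝ≥0} {J : ℕ} (hJ : 0 < J) {l : ℝ} (hl : 0 < l) {s : ℝ≥0} (hs : s ∈ Icc a b) :
    |(x s i : ℝ) - x a i| ≤
      (l + mu i) * (b - a) + blockError l (mu i) (A i) (S i) J a b := by
  have hab' : (0 : ℝ) ≤ b - a := sub_nonneg.2 (hs.1.trans hs.2)
  have hr := hmu i
  have hsub : Ioc (a : ℝ) s ⊆ Ioc (a : ℝ) b := Ioc_subset_Ioc_right hs.2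
  have h1 : (A i (Ioc (a : ℝ) s)).toReal ≤ (A i (Ioc (a : ℝ) b)).toReal :=
    ENNReal.toReal_mono (hx.arrivals_Ioc_lt_top i a b).ne (measure_mono hsub)
  have h2 : (S i (departureSet mu x i a s)).toReal ≤
      (S i (Icc 0 (mu i) ×ˢ Ioc (a : ℝ) b)).toReal := by
    refine ENNReal.toReal_mono (hx.services_Ioc_lt_top i a b).ne (measure_mono ?_)
    exact (hx.departureSet_subset fun _ _ =>
      mul_le_of_le_one_right hr.le (serviceShare_le_one _ _)).trans (prod_mono le_rfl hsub)
  -- The top level `j = J` is the full strip of height `mu i`, so its deviation is one of the terms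
  -- of the block error.
  have h3 := abs_le.1 (abs_services_sub_le_sum (r := mu i) (a := a) (b := b) (S := S i) (le_refl J))
  have hJ' : (J : ℝ) ≠ 0 := by exact_mod_cast hJ.ne'
  rw [mul_div_cancel_left₀ _ hJ'] at h3
  have h4 := abs_le.1 (le_refl |(A i (Ioc (a : ℝ) b)).toReal - l * (b - a)|)
  have h5 := mul_nonneg hl.le hab'
  have h6 := mul_nonneg hr.le hab'
  have h7 := abs_nonneg ((A i (Ioc (a : ℝ) b)).toReal - l * (b - a))
  have h8 : 0 ≤ ∑ j ∈ Finset.range (J + 1),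
        |(S i (Icc 0 (j * mu i / J) ×ˢ Ioc (a : ℝ) b)).toReal - j * mu i / J * (b - a)| :=
    Finset.sum_nonneg fun _ _ => abs_nonneg _
  have h9 : 0 ≤ (A i (Ioc (a : ℝ) s)).toReal := ENNReal.toReal_nonneg
  have h10 : 0 ≤ (S i (departureSet mu x i a s)).toReal := ENNReal.toReal_nonneg
  rw [hx.increment_eq hmu i hs.1, blockError, abs_le]
  constructor <;> linarith [h4.1, h4.2, h3.1, h3.2]

end IsQueuePath

/-! ### First moment of the block error -/

theorem IsQueueSolution.measurable_blockError {Ω : Type*} [MeasurableSpace Ω] {lam mu : Fin 2 → ℝ}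
    {P : Measure Ω} {A : Fin 2 → Ω → Measure ℝ} {S : Fin 2 → Ω → Measure (ℝ × ℝ)}
    {L : Ω → ℝ≥0 → Fin 2 → ℕ} (hL : IsQueueSolution lam mu P A S L) (i : Fin 2) (J : ℕ) (a b : ℝ) :
    Measurable fun ω => blockError (lam i) (mu i) (A i ω) (S i ω) J a b := by
  refine Measurable.add ?_ (Finset.measurable_sum _ fun j _ => ?_)
  · have := (hL.arrivals i).measurable_apply (measurableSet_Ioc (a := a) (b := b))
    exact (this.ennreal_toReal.sub_const _).abs
  · have := (hL.services i).measurable_apply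
      ((measurableSet_Icc (a := (0 : ℝ)) (b := j * mu i / J)).prod
        (measurableSet_Ioc (a := a) (b := b)))
    exact (this.ennreal_toReal.sub_const _).abs

/-- The factor `J + 2` counts the arrival term and the `J + 1` levels; each count has mean at most
`M`, hence expected deviation at most `√M`. -/
theorem IsQueueSolution.lintegral_blockError_le {Ω : Type*} [MeasurableSpace Ω]
    {lam mu : Fin 2 → ℝ}
    {P : Measure Ω} {A : Fin 2 → Ω → Measure ℝ} {S : Fin 2 → Ω → Measure (ℝ × ℝ)}
    {L : Ω → ℝ≥0 → Fin 2 → ℕ} (hL : IsQueueSolution lam mu P A S L) (hlam : ∀ i, 0 < lam i)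
    (hmu : ∀ i, 0 < mu i) (i : Fin 2) {J : ℕ} (hJ : 0 < J) {a b : ℝ} (ha : 0 ≤ a) (hab : a ≤ b)
    {M : ℝ} (hM : 0 < M) (hM' : (lam i + mu i) * (b - a) ≤ M) :
    ∫⁻ ω, ENNReal.ofReal (blockError (lam i) (mu i) (A i ω) (S i ω) J a b) ∂P ≤
      ENNReal.ofReal ((J + 2) * √M) := by
  have hab' : 0 ≤ b - a := by linarith
  have hJ' : (0 : ℝ) < J := by exact_mod_cast hJ
  have h1 := mul_nonneg (hlam i).le hab'
  have h2 := mul_nonneg (hmu i).le hab'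
  have hmA : Measurable fun ω => ENNReal.ofReal |(A i ω (Ioc a b)).toReal - lam i * (b - a)| :=
    (((hL.arrivals i).measurable_apply measurableSet_Ioc).ennreal_toReal.sub_const
      _).abs.ennreal_ofReal
  have hmS : ∀ j : ℕ, Measurable fun ω => ENNReal.ofReal
      |(S i ω (Icc 0 (j * mu i / J) ×ˢ Ioc a b)).toReal - j * mu i / J * (b - a)| := fun j =>
    (((hL.services i).measurable_apply
      (measurableSet_Icc.prod measurableSet_Ioc)).ennreal_toReal.sub_const _).abs.ennreal_ofReal
  have e : ∀ ω, ENNReal.ofReal (blockError (lam i) (mu i) (A i ω) (S i ω) J a b) =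
      ENNReal.ofReal |(A i ω (Ioc a b)).toReal - lam i * (b - a)| +
        ∑ j ∈ Finset.range (J + 1), ENNReal.ofReal
          |(S i ω (Icc 0 (j * mu i / J) ×ˢ Ioc a b)).toReal - j * mu i / J * (b - a)| := by
    intro ω
    rw [blockError, ENNReal.ofReal_add (abs_nonneg _)
      (Finset.sum_nonneg fun _ _ => abs_nonneg _),
      ENNReal.ofReal_sum_of_nonneg fun _ _ => abs_nonneg _]
  simp_rw [e]
  rw [lintegral_add_left hmA, lintegral_finsetSum _ fun j _ => hmS j]
  have hA := (hL.arrivals i).lintegral_abs_sub_le measurableSet_Ioc h1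
    (arrivalIntensity_Ioc (hlam i).le ha) hM (by linarith)
  have hS : ∀ j ∈ Finset.range (J + 1), ∫⁻ ω, ENNReal.ofReal
      |(S i ω (Icc 0 (j * mu i / J) ×ˢ Ioc a b)).toReal - j * mu i / J * (b - a)| ∂P ≤
        ENNReal.ofReal (√M) := by
    intro j hj
    have hjJ : (j : ℝ) ≤ J := by exact_mod_cast Nat.lt_succ_iff.1 (Finset.mem_range.1 hj)
    have hw0 : 0 ≤ j * mu i / J := by have := (hmu i).le; positivity
    have hw1 : j * mu i / J ≤ mu i := by
      rw [div_le_iff₀ hJ', mul_comm]; exact mul_le_mul_of_nonneg_left hjJ (hmu i).le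
    exact (hL.services i).lintegral_abs_sub_le (measurableSet_Icc.prod measurableSet_Ioc)
      (mul_nonneg hw0 hab') (serviceIntensity_Icc_prod_Ioc hw0 ha) hM
      (by nlinarith [mul_le_mul_of_nonneg_right hw1 hab'])
  refine (add_le_add hA (Finset.sum_le_sum hS)).trans_eq ?_
  rw [Finset.sum_const, Finset.card_range, nsmul_eq_mul, ENNReal.ofReal_mul (by positivity),
    ENNReal.ofReal_add (by positivity) (by positivity), ENNReal.ofReal_natCast]
  push_cast
  simp only [ENNReal.ofReal_ofNat]
  ring

/-! ### Deterministic comparison with the limiting function -/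

/-- First-order expansion of the service share when the two logarithms are close to `α ℓ + u` and
`ℓ`. -/
theorem exists_abs_share_expansion_le {α c ε : ℝ} (hα : 0 < α) (hc : 0 ≤ c) (hε : 0 < ε) :
    ∃ η ∈ Ioc (0 : ℝ) 1, ∀ ℓ u a b : ℝ, 1 ≤ η * ℓ → |u| ≤ c → |a - (α * ℓ + u)| ≤ η →
      |b - ℓ| ≤ η → |a / (a + b) - (α / (1 + α) + u / ((1 + α) ^ 2 * ℓ))| ≤ ε / ℓ := by
  set K := 2 + c * (c + 2) with hK
  have hK0 : 0 < K := by positivity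
  -- The bound `α / (c + 2)` forces `α * ℓ ≥ c + 2`, hence a denominator `a + b ≥ ℓ`; the bound `ε /
  -- K` absorbs the numerator of the error.
  refine ⟨min 1 (min (ε / K) (α / (c + 2))), ⟨by positivity, min_le_left _ _⟩, ?_⟩
  set η := min 1 (min (ε / K) (α / (c + 2)))
  have hη0 : 0 < η := by positivity
  have hη1 : η ≤ 1 := min_le_left _ _
  have hηK : η * K ≤ ε := by
    rw [← le_div_iff₀ hK0]; exact (min_le_right _ _).trans (min_le_left _ _)
  have hηα : η * (c + 2) ≤ α := by
    rw [← le_div_iff₀ (by positivity)]; exact (min_le_right _ _).trans (min_le_right _ _)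
  intro ℓ u a b hℓ hu ha hb
  have hℓ0 : 0 < ℓ := (mul_pos_iff_of_pos_left hη0).1 (one_pos.trans_le hℓ)
  have hℓα : c + 2 ≤ α * ℓ := by nlinarith
  have hu' := abs_le.1 hu
  have ha' := abs_le.1 ha
  have hb' := abs_le.1 hb
  have hab : ℓ ≤ a + b := by linarith [hu'.1, ha'.1, hb'.1]
  have hab0 : 0 < a + b := by linarith
  set p := a - (α * ℓ + u) with hp
  set q := b - ℓ with hq
  -- Exact error formula: the numerator has a part linear in the perturbations `p`, `q`, of size
  -- `η`, and a part of size `1/ℓ ≤ η`.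
  have e : a / (a + b) - (α / (1 + α) + u / ((1 + α) ^ 2 * ℓ)) =
      ((p - α * q) / (1 + α) - u * (u + p + q) / ((1 + α) ^ 2 * ℓ)) / (a + b) := by
    rw [hp, hq]
    field_simp
    ring
  rw [e, abs_div, abs_of_pos hab0]
  have h1 : |(p - α * q) / (1 + α)| ≤ η := by
    rw [abs_div, abs_of_pos (show 0 < 1 + α by linarith), div_le_iff₀ (by linarith)]
    calc |p - α * q| ≤ |p| + |α * q| := abs_sub _ _
      _ ≤ η + α * η := by rw [abs_mul, abs_of_pos hα]; gcongr
      _ = η * (1 + α) := by ring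
  have h2 : |u * (u + p + q) / ((1 + α) ^ 2 * ℓ)| ≤ c * (c + 2) * η := by
    rw [abs_div, abs_of_pos (show 0 < (1 + α) ^ 2 * ℓ by positivity),
      div_le_iff₀ (by positivity), abs_mul]
    have h3 : |u + p + q| ≤ c + 2 := by
      rw [abs_le]; constructor <;> linarith [hu'.1, ha'.1, hb'.1, hu'.2, ha'.2, hb'.2]
    have h4 : 1 ≤ η * ((1 + α) ^ 2 * ℓ) := by
      have : (1 : ℝ) ≤ (1 + α) ^ 2 := by nlinarith
      nlinarith
    calc |u| * |u + p + q| ≤ c * (c + 2) := by gcongr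
      _ ≤ c * (c + 2) * (η * ((1 + α) ^ 2 * ℓ)) := le_mul_of_one_le_right (by positivity) h4
      _ = _ := by ring
  have h3 : |(p - α * q) / (1 + α) - u * (u + p + q) / ((1 + α) ^ 2 * ℓ)| ≤ ε :=
    (abs_sub _ _).trans (by nlinarith)
  gcongr

/-- On `[a, ∞)` the slope of `q log` lies in `[0, q/a] ⊆ [0, 1]`, so the Euler map `u ↦ u - q log u`
is nonexpansive. This is why no Grönwall factor appears. -/
theorem abs_sub_mul_log_sub_le {a q u v : ℝ} (ha : 0 < a) (hu : a ≤ u) (hv : a ≤ v) (hq : 0 ≤ q)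
    (hqa : q ≤ a) : |(u - q * Real.log u) - (v - q * Real.log v)| ≤ |u - v| := by
  wlog huv : v ≤ u generalizing u v
  · rw [abs_sub_comm, abs_sub_comm u]
    exact this hv hu (not_le.1 huv).le
  have h1 := Real.log_le_log (ha.trans_le hv) huv
  have h2 := (abs_le.1 (abs_log_sub_log_le ha hu hv)).2
  rw [abs_of_nonneg (sub_nonneg.2 huv), le_div_iff₀ ha] at h2
  have h3 : q * (Real.log u - Real.log v) ≤ (Real.log u - Real.log v) * a := by
    rw [mul_comm]; gcongr
  have h4 := mul_nonneg hq (sub_nonneg.2 h1)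
  rw [abs_of_nonneg (sub_nonneg.2 huv), abs_le]
  constructor <;> linarith

/-- One step of the comparison of two perturbed Euler schemes. -/
theorem abs_euler_step_sub_le {a q u v u' v' e₁ e₂ : ℝ} (ha : 0 < a) (hu : a ≤ u) (hv : a ≤ v)
    (hq : 0 ≤ q) (hqa : q ≤ a) (h₁ : |u' - (u - q * Real.log u)| ≤ e₁)
    (h₂ : |v' - v + q * Real.log v| ≤ e₂) : |u' - v'| ≤ |u - v| + e₁ + e₂ := by
  have h := abs_sub_mul_log_sub_le ha hu hv hq hqa
  rw [abs_le] at h h₁ h₂ ⊢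
  constructor <;> linarith [h.1, h.2, h₁.1, h₁.2, h₂.1, h₂.2]

set_option maxHeartbeats 400000 in
/-- The first coordinate of a queue path whose driving measures are close to their means stays
close to the limiting function. -/
theorem exists_tolerance {lam mu : Fin 2 → ℝ} (hlam : ∀ i, 0 < lam i) (hmu : ∀ i, 0 < mu i)
    {α δ C : ℝ} (hα : 0 < α) (hδ : δ ∈ Ioc (0 : ℝ) 1) (hl : lam 0 = α / (1 + α) * mu 0)
    {h : ℝ≥0 → ℝ} (hC : 0 ≤ C) (h0 : h 0 = δ) (hmem : ∀ t, h t ∈ Icc δ 1)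
    (hexp : ∀ t s : ℝ≥0, t ≤ s → |h s - h t| ≤ C * (s - t) ∧
      |h s - h t + mu 0 / (1 + α) ^ 2 * (s - t) * Real.log (h t)| ≤ C * ((s : ℝ) - t) ^ 2)
    {T ε : ℝ} (hT : 0 ≤ T) (hε : 0 < ε) :
    ∃ η ∈ Ioc (0 : ℝ) 1, ∀ {A : Fin 2 → Measure ℝ} {S : Fin 2 → Measure (ℝ × ℝ)}
      {x : ℝ≥0 → Fin 2 → ℕ}, IsQueuePath mu A S x → ∀ {ℓ m : ℝ} {B : ℝ≥0} {J n : ℕ}, 0 < m →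
      Real.log m = α * ℓ → 1 ≤ η * ℓ → 1 ≤ η * m → 0 < B → B ≤ η * m → 0 < J → ℓ ≤ η * J →
      n * B ≤ (T + 1) * (m * ℓ) → (∀ s ≤ n * B, |Real.log (1 + x s 1) - ℓ| ≤ η) →
      |(x 0 0 : ℝ) / m - δ| ≤ η →
      ∑ k ∈ Finset.range n, blockError (lam 0) (mu 0) (A 0) (S 0) J ((k * B : ℝ≥0) : ℝ)
        (((k + 1 : ℕ) * B : ℝ≥0) : ℝ) ≤ η * m →
      ∀ t : ℝ≥0, t * (m * ℓ) < n * B → |(x ((m * ℓ).toNNReal * t) 0 : ℝ) / m - h t| ≤ ε := by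
  have hδ0 := hδ.1
  have hμ := hmu 0
  have hl0 := hlam 0
  set κ := mu 0 / (1 + α) ^ 2 with hκ
  have hκ0 : 0 < κ := by positivity
  -- Error allowed at block ends: `δ / 2` keeps the scheme away from `0`, where `log` is singular,
  -- and `ε / 2` leaves room for the oscillation inside a block.
  set ε' := min (ε / 2) (δ / 2) with hε'
  have hε'0 : 0 < ε' := by positivity
  set c := max |Real.log (δ / 2)| |Real.log 2| with hc
  set ε₁ := ε' / (4 * (T + 1)) with hε₁
  have hε₁0 : 0 < ε₁ := by positivity
  obtain ⟨η₀, hη₀, hdrift⟩ := exists_abs_share_expansion_le (α := α) (c := c) (ε := ε₁ / mu 0) hα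
    (by positivity) (by positivity)
  set D := lam 0 + mu 0 + 2 with hD
  -- Dominates every multiple of `η` needed below, so that one choice of `η` makes them all small.
  set K := 1 + D + D * 4 / δ + κ + C + 2 + (T + 1) * (mu 0 + C) with hK
  have hD0 : 0 < D := by positivity
  have hK0 : 0 < K := by positivity
  set η := min (min 1 η₀) (min (ε' / 2) (δ / 4)) / K with hη
  have hη0 : 0 < η := by have := hη₀.1; positivity
  have hηK : K * η = min (min 1 η₀) (min (ε' / 2) (δ / 4)) := by rw [hη]; field_simp
  have hsmall : ∀ k ≤ K, k * η ≤ 1 ∧ k * η ≤ η₀ ∧ k * η ≤ ε' / 2 ∧ k * η ≤ δ / 4 := by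
    intro k hk
    have := (mul_le_mul_of_nonneg_right hk hη0.le).trans_eq hηK
    exact ⟨this.trans ((min_le_left _ _).trans (min_le_left _ _)),
      this.trans ((min_le_left _ _).trans (min_le_right _ _)),
      this.trans ((min_le_right _ _).trans (min_le_left _ _)),
      this.trans ((min_le_right _ _).trans (min_le_right _ _))⟩
  have hTμ : 0 ≤ (T + 1) * (mu 0 + C) := by positivity
  have hDδ : 0 ≤ D * 4 / δ := by positivity
  have hη1 := hsmall 1 (by linarith)
  rw [one_mul] at hη1
  have hηD := hsmall D (by linarith)
  have hηDδ := hsmall (D * 4 / δ) (by linarith)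
  have hηκ := hsmall κ (by linarith)
  have hηDC := hsmall (D + C) (by linarith)
  have hηT := hsmall (2 + (T + 1) * (mu 0 + C)) (by linarith)
  clear_value η K D κ ε' ε₁ c
  refine ⟨η, ⟨hη0, hη1.1⟩, ?_⟩
  intro A S x hx ℓ m B J n hm hlogm hℓ hm1 hB hBm hJ hJℓ hnB hL2 hx0 herr
  have hℓ0 : 0 < ℓ := (mul_pos_iff_of_pos_left hη0).1 (one_pos.trans_le hℓ)
  have hℓ1 : 1 ≤ ℓ := hℓ.trans (mul_le_of_le_one_left hℓ0.le hη1.1)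
  have hmℓ : 0 < m * ℓ := mul_pos hm hℓ0
  have hB' : (0 : ℝ) < B := hB
  set τ : ℝ≥0 := B / (m * ℓ).toNNReal with hτ
  have hτr : (τ : ℝ) = B / (m * ℓ) := by
    rw [hτ, NNReal.coe_div, Real.coe_toNNReal _ hmℓ.le]
  have hτ0 : 0 ≤ (τ : ℝ) := τ.2
  have hτη : (τ : ℝ) ≤ η := by
    rw [hτr, div_le_iff₀ hmℓ]
    refine hBm.trans ?_
    gcongr
    exact le_mul_of_one_le_right hm.le hℓ1
  set err : ℕ → ℝ := fun k => blockError (lam 0) (mu 0) (A 0) (S 0) J ((k * B : ℝ≥0) : ℝ)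
        (((k + 1 : ℕ) * B : ℝ≥0) : ℝ) with herrdef
  have herr0 : ∀ k, 0 ≤ err k := fun k => blockError_nonneg
  have herrk : ∀ k < n, err k ≤ η * m := fun k hk =>
    (Finset.single_le_sum (fun k _ => herr0 k) (Finset.mem_range.2 hk)).trans herr
  have hlen : ∀ k : ℕ, (((k + 1 : ℕ) * B : ℝ≥0) : ℝ) - ((k * B : ℝ≥0) : ℝ) = B := by
    intro k; push_cast; ring
  have hkk : ∀ k : ℕ, (k : ℝ≥0) * B ≤ (k + 1 : ℕ) * B := by
    intro k; gcongr; simp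
  -- Of the `2` in `D`, one unit pays here for the block error; the other pays later for the `1` in
  -- `log (1 + x)`, as `1 ≤ η * m`.
  have hosc : ∀ k < n, ∀ s ∈ Icc ((k : ℝ≥0) * B) ((k + 1 : ℕ) * B),
      |(x s 0 : ℝ) - x (k * B) 0| ≤ (D - 1) * η * m := by
    intro k hk s hs
    refine (hx.abs_sub_le hmu hJ hl0 hs).trans ?_
    rw [hlen k]
    have := herrk k hk
    have h2 : (lam 0 + mu 0) * B ≤ (lam 0 + mu 0) * (η * m) := by gcongr
    rw [hD]
    simp only [herrdef] at this
    linarith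
  have hstep : ∀ k < n, δ / 2 ≤ (x (k * B) 0 : ℝ) / m → (x (k * B) 0 : ℝ) / m ≤ 2 →
      |(x ((k + 1 : ℕ) * B) 0 : ℝ) / m - h ((k + 1 : ℕ) * τ)| ≤
        |(x (k * B) 0 : ℝ) / m - h (k * τ)| + err k / m + τ * (ε₁ + (mu 0 + C) * η) := by
    intro k hk hlo hhi
    set X : ℝ := (x (k * B) 0 : ℝ) / m with hX
    have hX0 : 0 < X := by linarith
    have hXm : (x (k * B) 0 : ℝ) = X * m := by rw [hX]; field_simp
    have hlogX : |Real.log X| ≤ c := by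
      rw [abs_le]
      have h1 := Real.log_le_log (by positivity) hlo
      have h2 := Real.log_le_log hX0 hhi
      constructor
      · linarith [neg_abs_le (Real.log (δ / 2)), le_max_left |Real.log (δ / 2)| |Real.log 2|]
      · linarith [le_abs_self (Real.log 2), le_max_right |Real.log (δ / 2)| |Real.log 2|]
    have hrate : ∀ s ∈ Icc ((k : ℝ≥0) * B) ((k + 1 : ℕ) * B),
        |mu 0 * serviceShare (x s) 0 - (lam 0 + κ * Real.log X / ℓ)| ≤ ε₁ / ℓ := by
      intro s hs
      have hsn : s ≤ n * B := hs.2.trans (by gcongr; exact_mod_cast hk)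
      have h1 := hosc k hk s hs
      rw [hXm] at h1
      have h2 : |(1 + x s 0 : ℝ) - X * m| ≤ D * η * m := by
        have h1' := abs_le.1 h1
        rw [abs_le]; constructor <;> linarith [h1'.1, h1'.2]
      have h3 : δ / 2 * m ≤ X * m := by gcongr
      have h5 : D * η * m ≤ δ / 4 * m := by gcongr; exact hηD.2.2.2
      have h4 : δ / 4 * m ≤ 1 + x s 0 := by linarith [(abs_le.1 h2).1]
      have h6 : |Real.log (1 + x s 0) - (α * ℓ + Real.log X)| ≤ η₀ := by
        rw [← hlogm, add_comm (Real.log m), ← Real.log_mul hX0.ne' hm.ne']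
        refine (abs_log_sub_log_le (show 0 < δ / 4 * m by positivity) h4 (by linarith [mul_pos hδ0 hm])).trans ?_
        refine le_trans ?_ hηDδ.2.1
        rw [div_le_iff₀ (by positivity)]
        refine h2.trans_eq ?_
        field_simp
      have h7 := hdrift ℓ (Real.log X) (Real.log (1 + x s 0)) (Real.log (1 + x s 1))
        (hℓ.trans (by gcongr; exact hη1.2.1)) hlogX h6 ((hL2 s hsn).trans hη1.2.1)
      -- By the balance `hl`, the constant term of the share expansion cancels the arrival rate.
      have e : mu 0 * serviceShare (x s) 0 - (lam 0 + κ * Real.log X / ℓ) =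
          mu 0 * (Real.log (1 + x s 0) / (Real.log (1 + x s 0) + Real.log (1 + x s 1)) -
            (α / (1 + α) + Real.log X / ((1 + α) ^ 2 * ℓ))) := by
        rw [serviceShare, hl, hκ]; field_simp
      rw [e, abs_mul, abs_of_pos hμ]
      calc _ ≤ mu 0 * (ε₁ / mu 0 / ℓ) := by gcongr
        _ = ε₁ / ℓ := by field_simp
    have h1 := hx.abs_increment_sub_le hmu (hkk k) hJ (l := lam 0) hrate
    rw [hlen k] at h1
    set Y : ℝ := (x ((k + 1 : ℕ) * B) 0 : ℝ) / m with hY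
    have hYm : (x ((k + 1 : ℕ) * B) 0 : ℝ) = Y * m := by rw [hY]; field_simp
    rw [hXm, hYm] at h1
    have h2 : |Y - (X - κ * τ * Real.log X)| ≤ err k / m + τ * (ε₁ + mu 0 * η) := by
      have e : Y - (X - κ * τ * Real.log X) =
          (Y * m - X * m - (lam 0 - (lam 0 + κ * Real.log X / ℓ)) * B) / m := by
        rw [hτr]; field_simp; ring
      rw [e, abs_div, abs_of_pos hm, div_le_iff₀ hm]
      refine h1.trans ?_
      have hJ' : (0 : ℝ) < J := by exact_mod_cast hJ
      -- The grid mesh must be small even against the drift, which is only of order `1/ℓ`; hence the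
      -- assumption `ℓ ≤ η * J`.
      have h3 : mu 0 / J ≤ mu 0 * η / ℓ := by
        rw [div_le_div_iff₀ hJ' hℓ0, mul_assoc]; gcongr
      calc err k + (ε₁ / ℓ + mu 0 / J) * B ≤ err k + (ε₁ / ℓ + mu 0 * η / ℓ) * B := by gcongr
        _ = _ := by rw [hτr]; field_simp
    have hkτ : (k : ℝ≥0) * τ ≤ (k + 1 : ℕ) * τ := by gcongr; simp
    have hlenτ : (((k + 1 : ℕ) * τ : ℝ≥0) : ℝ) - ((k * τ : ℝ≥0) : ℝ) = τ := by push_cast; ring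
    have h3 := (hexp _ _ hkτ).2
    rw [hlenτ] at h3
    have h4 : C * (τ : ℝ) ^ 2 ≤ τ * (C * η) := by
      have : (τ : ℝ) ^ 2 ≤ τ * η := by rw [sq]; gcongr
      linarith [mul_le_mul_of_nonneg_left this hC]
    have h5 : κ * (τ : ℝ) ≤ δ / 2 := by
      have := mul_le_mul_of_nonneg_left hτη hκ0.le
      linarith [hηκ.2.2.2]
    refine (abs_euler_step_sub_le (show 0 < δ / 2 by positivity) hlo
      (show δ / 2 ≤ h (k * τ) by linarith [(hmem (k * τ)).1]) (by positivity) h5 h2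
      (h3.trans h4)).trans_eq ?_
    ring
  have hbudget : ∀ k ≤ n, η + (∑ i ∈ Finset.range k, err i) / m +
      k * (τ * (ε₁ + (mu 0 + C) * η)) ≤ ε' := by
    intro k hk
    have h1 : (∑ i ∈ Finset.range k, err i) / m ≤ η := by
      rw [div_le_iff₀ hm]
      refine le_trans (Finset.sum_le_sum_of_subset_of_nonneg ?_ fun i _ _ => herr0 i) herr
      exact Finset.range_subset_range.2 hk
    have h2 : (k : ℝ) * τ ≤ T + 1 := by
      rw [hτr, ← mul_div_assoc, div_le_iff₀ hmℓ]
      refine le_trans ?_ hnB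
      gcongr
    have h3 : k * (τ * (ε₁ + (mu 0 + C) * η)) ≤ (T + 1) * (ε₁ + (mu 0 + C) * η) := by
      rw [← mul_assoc]; gcongr
    have h4 : (T + 1) * ε₁ = ε' / 4 := by rw [hε₁]; field_simp
    have h5 := hηT.2.2.1
    linarith
  -- Bootstrap: by `hbudget` the error so far is at most `ε' ≤ δ / 2`, so the scheme is still in `[δ
  -- / 2, 2]`, where `hstep` is valid.
  have hind : ∀ k ≤ n, |(x (k * B) 0 : ℝ) / m - h (k * τ)| ≤
      η + (∑ i ∈ Finset.range k, err i) / m + k * (τ * (ε₁ + (mu 0 + C) * η)) := by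
    intro k
    induction k with
    | zero => intro _; simpa [h0] using hx0
    | succ k ih =>
      intro hk
      have h1 := ih (by omega)
      have h2 := abs_le.1 (h1.trans (hbudget k (by omega)))
      have h3 := hmem (k * τ)
      have h4 : ε' ≤ δ / 2 := hε'.trans_le (min_le_right _ _)
      refine (hstep k hk (by linarith [h3.1, h2.1]) (by linarith [h3.2, h2.2, hδ.2])).trans ?_
      rw [Finset.sum_range_succ, add_div]
      push_cast
      linarith
  intro t ht
  have hτ0' : 0 < τ := div_pos hB (Real.toNNReal_pos.2 hmℓ)
  have hcτ : (m * ℓ).toNNReal * τ = B := mul_div_cancel₀ _ (Real.toNNReal_pos.2 hmℓ).ne'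
  set k := ⌊t / τ⌋₊ with hk
  have hk1 : (k : ℝ≥0) * τ ≤ t := by
    rw [← le_div_iff₀ hτ0']; exact Nat.floor_le (by positivity)
  have hk2 : t ≤ (k + 1 : ℕ) * τ := by
    rw [← div_le_iff₀ hτ0']; push_cast; exact (Nat.lt_floor_add_one _).le
  have hkn : k < n := by
    have h1 : (k : ℝ) * τ ≤ t := by exact_mod_cast hk1
    rw [hτr, ← mul_div_assoc, div_le_iff₀ hmℓ] at h1
    have h2 : (k : ℝ) < n := lt_of_mul_lt_mul_right (h1.trans_lt ht) hB'.le
    exact_mod_cast h2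
  have hs : (m * ℓ).toNNReal * t ∈ Icc ((k : ℝ≥0) * B) ((k + 1 : ℕ) * B) := by
    rw [← hcτ, mul_left_comm, mul_left_comm (_ : ℝ≥0) (m * ℓ).toNNReal]
    exact ⟨mul_le_mul_right hk1 _, mul_le_mul_right hk2 _⟩
  have h1 := hosc k hkn _ hs
  have h1' : |(x ((m * ℓ).toNNReal * t) 0 : ℝ) / m - (x (k * B) 0 : ℝ) / m| ≤ (D - 1) * η := by
    rw [← sub_div, abs_div, abs_of_pos hm, div_le_iff₀ hm]; exact h1
  have h2 := (hind k hkn.le).trans (hbudget k hkn.le)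
  have h3 : |h t - h (k * τ)| ≤ C * η := by
    refine (hexp _ _ hk1).1.trans ?_
    gcongr
    have h4 : (t : ℝ) ≤ (k + 1) * τ := by exact_mod_cast hk2
    push_cast
    linarith
  have h4 := hηDC.2.2.1
  have h5 : ε' ≤ ε / 2 := hε'.trans_le (min_le_left _ _)
  have h1a := abs_le.1 h1'
  have h2a := abs_le.1 h2
  have h3a := abs_le.1 h3
  rw [abs_le]
  constructor <;> linarith

/-! ### Convergence to a deterministic path -/

theorem CadlagPath.exists_forall_abs_sub_le_imp (f : CadlagPath →ᵇ ℝ) (y : CadlagPath) {ε : ℝ}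
    (hε : 0 < ε) : ∃ (T : ℝ≥0) (r : ℝ), 0 < r ∧ ∀ x : CadlagPath,
      (∀ t ≤ T, |x.toFun t - y.toFun t| ≤ r) → |f x - f y| < ε := by
  have h1 : {x | |f x - f y| < ε} ∈ 𝓝 y :=
    f.continuous.continuousAt.preimage_mem_nhds (Metric.ball_mem_nhds (f y) hε)
  rw [nhds_induced, mem_comap] at h1
  obtain ⟨U, hU, hUf⟩ := h1
  obtain ⟨⟨K, V⟩, ⟨hK, hV⟩, hKV⟩ := ((UniformOnFun.hasBasis_nhds ℝ≥0 ℝ {K : Set ℝ≥0 | IsCompact K}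
    (UniformOnFun.ofFun {K : Set ℝ≥0 | IsCompact K} y.toFun) ⟨∅, isCompact_empty⟩
    (fun K hK K' hK' => ⟨K ∪ K', IsCompact.union hK hK', subset_union_left,
      subset_union_right⟩)).mem_iff).1 hU
  obtain ⟨r, hr, hrV⟩ := Metric.mem_uniformity_dist.1 hV
  obtain ⟨T, hT⟩ := IsCompact.bddAbove hK
  refine ⟨T, r / 2, by positivity, fun x hx => hUf (hKV fun t ht => hrV ?_)⟩
  rw [Real.dist_eq]
  exact (hx t (hT ht)).trans_lt (half_lt_self hr)

/-- As the limit is one path `y`, continuity of the test function at `y` suffices: `f (Z N)` is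
close to `f y` off `F N`, and the difference is at most `2‖f‖` elsewhere. -/
theorem convergesInLaw_dirac {Ω : ℕ → Type*} [∀ N, MeasurableSpace (Ω N)] {P : ∀ N, Measure (Ω N)}
    [∀ N, IsProbabilityMeasure (P N)] {Z : ∀ N, Ω N → CadlagPath} (hZ : ∀ N, Measurable (Z N))
    {y : CadlagPath}
    (h : ∀ (T : ℝ≥0) (ε : ℝ), 0 < ε → ∃ F : ∀ N, Set (Ω N),
      Tendsto (fun N => P N (F N)) atTop (𝓝 0) ∧ ∀ᶠ N in atTop, ∀ᵐ ω ∂(P N), ω ∉ F N →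
        ∀ t ≤ T, |(Z N ω).toFun t - y.toFun t| ≤ ε) :
    ConvergesInLaw P Z (Measure.dirac y) := by
  refine ⟨hZ, fun f hf => ?_⟩
  rw [integral_dirac' _ _ hf.stronglyMeasurable, Metric.tendsto_nhds]
  intro ε hε
  obtain ⟨T, r, hr, hTr⟩ := CadlagPath.exists_forall_abs_sub_le_imp f y (half_pos hε)
  obtain ⟨F, hF, hF'⟩ := h T r hr
  have hFr : Tendsto (fun N => 2 * ‖f‖ * (P N).real (F N)) atTop (𝓝 0) := by
    simpa [Measure.real, Function.comp_def] using ((ENNReal.tendsto_toReal ENNReal.zero_ne_top).comp hF).const_mul (2 * ‖f‖)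
  filter_upwards [hF', hFr.eventually_lt_const (half_pos hε)] with N hN hN'
  -- `F N` may fail to be measurable, so the integral is split along `E`, which is almost surely
  -- contained in `F N`.
  set E : Set (Ω N) := {ω | ε / 2 ≤ |f (Z N ω) - f y|} with hE
  have hfZ : Measurable fun ω => f (Z N ω) := hf.comp (hZ N)
  have hEm : MeasurableSet E := measurableSet_le measurable_const (hfZ.sub_const _).abs
  have hEF : (P N).real E ≤ (P N).real (F N) := by
    refine ENNReal.toReal_mono (measure_ne_top _ _) (measure_mono_ae ?_)
    filter_upwards [hN] with ω hω hωE
    by_contra hωF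
    exact absurd (hTr _ (hω hωF)) (not_lt.2 hωE)
  have hbound : ∀ ω, |f (Z N ω) - f y| ≤ 2 * ‖f‖ := fun ω => by
    rw [← Real.norm_eq_abs, two_mul]
    exact (norm_sub_le _ _).trans (add_le_add (f.norm_coe_le_norm _) (f.norm_coe_le_norm _))
  have hint : Integrable (fun ω => f (Z N ω)) (P N) :=
    Integrable.of_bound hfZ.aestronglyMeasurable ‖f‖ (ae_of_all _ fun ω => f.norm_coe_le_norm _)
  have hle : ∀ ω, |f (Z N ω) - f y| ≤ ε / 2 + E.indicator (fun _ => 2 * ‖f‖) ω := by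
    intro ω
    by_cases hω : ω ∈ E
    · rw [indicator_of_mem hω]; linarith [hbound ω]
    · rw [indicator_of_notMem hω, add_zero]; exact (not_le.1 hω).le
  have hi2 : Integrable (E.indicator fun _ => 2 * ‖f‖) (P N) :=
    (integrable_const _).indicator hEm
  rw [Real.dist_eq]
  calc |∫ ω, f (Z N ω) ∂(P N) - f y| = |∫ ω, (f (Z N ω) - f y) ∂(P N)| := by
        rw [integral_sub hint (integrable_const _)]; simp
    _ ≤ ∫ ω, |f (Z N ω) - f y| ∂(P N) := abs_integral_le_integral_abs
    _ ≤ ∫ ω, (ε / 2 + E.indicator (fun _ => 2 * ‖f‖) ω) ∂(P N) :=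
        integral_mono (hint.sub (integrable_const _)).abs ((integrable_const _).add hi2) hle
    _ = ε / 2 + (P N).real E * (2 * ‖f‖) := by
        rw [integral_add (integrable_const _) hi2, integral_indicator_const _ hEm]; simp
    _ ≤ ε / 2 + 2 * ‖f‖ * (P N).real (F N) := by
        rw [mul_comm]; gcongr
    _ < ε := by linarith

theorem measurable_scaledFirst {Ω : Type*} [MeasurableSpace Ω] {L : Ω → ℝ≥0 → Fin 2 → ℕ}
    (hL : ∀ t, Measurable fun ω => L ω t) (hc : ∀ ω, IsCadlag (L ω)) (c : ℝ≥0) (a : ℝ) :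
    Measurable fun ω => scaledFirst (L ω) (hc ω) c a := by
  rw [measurable_comap_iff, measurable_pi_iff]
  intro t
  have h1 : Measurable fun ω => L ω (c * t) 0 := (measurable_pi_apply 0).comp (hL (c * t))
  have h2 : Measurable fun k : ℕ => (k : ℝ) / a := measurable_from_top
  exact h2.comp h1

/-! ### Probability estimates for the driving measures -/

theorem measure_ge_le_of_lintegral_le {Ω : Type*} [MeasurableSpace Ω] {P : Measure Ω} {X : Ω → ℝ}
    (hX : Measurable X) {c e : ℝ} (hc : 0 < c) (h : ∫⁻ ω, ENNReal.ofReal (X ω) ∂P ≤ ENNReal.ofReal e) :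
    P {ω | c ≤ X ω} ≤ ENNReal.ofReal (e / c) := by
  have h1 : {ω | c ≤ X ω} ⊆ {ω | ENNReal.ofReal c ≤ ENNReal.ofReal (X ω)} := fun ω hω =>
    ENNReal.ofReal_le_ofReal hω
  refine (measure_mono h1).trans ((meas_ge_le_lintegral_div hX.ennreal_ofReal.aemeasurable
    (by simpa using hc) ENNReal.ofReal_ne_top).trans ?_)
  rw [ENNReal.ofReal_div_of_pos hc]
  gcongr

theorem IsQueueSolution.measure_sum_blockError_ge_le {Ω : Type*} [MeasurableSpace Ω]
    {lam mu : Fin 2 → ℝ}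
    {P : Measure Ω} {A : Fin 2 → Ω → Measure ℝ} {S : Fin 2 → Ω → Measure (ℝ × ℝ)}
    {L : Ω → ℝ≥0 → Fin 2 → ℕ} (hL : IsQueueSolution lam mu P A S L) (hlam : ∀ i, 0 < lam i)
    (hmu : ∀ i, 0 < mu i) (i : Fin 2) {J : ℕ} (hJ : 0 < J) (n : ℕ) {B : ℝ≥0} (hB : 0 < B)
    {c : ℝ} (hc : 0 < c) :
    P {ω | c ≤ ∑ k ∈ Finset.range n, blockError (lam i) (mu i) (A i ω) (S i ω) J
        ((k * B : ℝ≥0) : ℝ) (((k + 1 : ℕ) * B : ℝ≥0) : ℝ)} ≤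
      ENNReal.ofReal (n * ((J + 2) * √((lam i + mu i) * B)) / c) := by
  refine measure_ge_le_of_lintegral_le
    (Finset.measurable_sum _ fun k _ => hL.measurable_blockError i J _ _) hc ?_
  simp_rw [ENNReal.ofReal_sum_of_nonneg fun k _ => blockError_nonneg]
  rw [lintegral_finsetSum _ fun k _ => (hL.measurable_blockError i J _ _).ennreal_ofReal]
  have hB' : (0 : ℝ) < B := hB
  have h : ∀ k ∈ Finset.range n, ∫⁻ ω, ENNReal.ofReal (blockError (lam i) (mu i) (A i ω) (S i ω) J
        ((k * B : ℝ≥0) : ℝ) (((k + 1 : ℕ) * B : ℝ≥0) : ℝ)) ∂P ≤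
          ENNReal.ofReal ((J + 2) * √((lam i + mu i) * B)) := by
    intro k _
    refine hL.lintegral_blockError_le hlam hmu i hJ (NNReal.coe_nonneg _) ?_
      (mul_pos (add_pos (hlam i) (hmu i)) hB') (le_of_eq ?_)
    · exact NNReal.coe_le_coe.2 (by gcongr; simp)
    · push_cast; ring
  refine (Finset.sum_le_sum h).trans_eq ?_
  rw [Finset.sum_const, Finset.card_range, nsmul_eq_mul, ENNReal.ofReal_mul (Nat.cast_nonneg n),
    ENNReal.ofReal_natCast]

theorem tendsto_log_pow_div_rpow {s : ℝ} (hs : 0 < s) (k : ℕ) :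
    Tendsto (fun N : ℕ => Real.log N ^ k / (N : ℝ) ^ s) atTop (𝓝 0) := by
  have h := (isLittleO_log_rpow_rpow_atTop (k : ℝ) hs).tendsto_div_nhds_zero.comp
    (tendsto_natCast_atTop_atTop (R := ℝ))
  simpa [Function.comp_def, Real.rpow_natCast] using h

/-! ### The second queue -/

/-- On a time interval short compared with its initial value, the second queue does not move on
the logarithmic scale. -/
theorem IsQueuePath.abs_log_second_sub_le {lam mu : Fin 2 → ℝ} (hlam : ∀ i, 0 < lam i)
    (hmu : ∀ i, 0 < mu i) {A : Fin 2 → Measure ℝ} {S : Fin 2 → Measure (ℝ × ℝ)}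
    {x : ℝ≥0 → Fin 2 → ℕ} (hx : IsQueuePath mu A S x) {N : ℕ} (hN : 0 < N) (hx0 : x 0 1 = N)
    {η : ℝ} (hη : η ∈ Ioc (0 : ℝ) 1) {H : ℝ≥0} (hH : (lam 1 + mu 1) * H + 1 ≤ η / 4 * N)
    (herr : blockError (lam 1) (mu 1) (A 1) (S 1) 1 0 H ≤ η / 4 * N) {s : ℝ≥0} (hs : s ≤ H) :
    |Real.log (1 + x s 1) - Real.log N| ≤ η := by
  have hN' : (0 : ℝ) < N := by exact_mod_cast hN
  -- One block and the trivial grid suffice, since only the crude oscillation bound is needed here.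
  have h1 := hx.abs_sub_le hmu (i := 1) (J := 1) one_pos (hlam 1) (a := 0) (b := H)
    (s := s) ⟨zero_le, hs⟩
  rw [hx0, NNReal.coe_zero, sub_zero] at h1
  have h2 : |(1 + x s 1 : ℝ) - N| ≤ η * (N / 2) := by
    have := abs_le.1 h1
    rw [abs_le]
    constructor <;> linarith [this.1, this.2]
  have h3 : (N : ℝ) / 2 ≤ 1 + x s 1 := by
    have : η * ((N : ℝ) / 2) ≤ N / 2 := mul_le_of_le_one_left (by positivity) hη.2
    linarith [(abs_le.1 h2).1]
  refine (abs_log_sub_log_le (show (0 : ℝ) < N / 2 by positivity) h3 (by linarith)).trans ?_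
  rwa [div_le_iff₀ (by positivity)]

/-! ### The main result -/

theorem tendsto_ofReal_div_of_tendsto_atTop {u : ℕ → ℝ} (hu : Tendsto u atTop atTop) (C : ℝ) :
    Tendsto (fun N => ENNReal.ofReal (C / u N)) atTop (𝓝 0) := by
  simpa using ENNReal.tendsto_ofReal (hu.const_div_atTop C)

theorem exists_failureSet {lam mu : Fin 2 → ℝ} (hlam : ∀ i, 0 < lam i) (hmu : ∀ i, 0 < mu i)
    {α δ C : ℝ} (hα : 0 < α) (hα1 : α < 1) (hδ : δ ∈ Ioc (0 : ℝ) 1)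
    (hl : lam 0 = α / (1 + α) * mu 0)
    {h : ℝ≥0 → ℝ} (hC : 0 ≤ C) (h0 : h 0 = δ) (hmem : ∀ t, h t ∈ Icc δ 1)
    (hexp : ∀ t s : ℝ≥0, t ≤ s → |h s - h t| ≤ C * (s - t) ∧
      |h s - h t + mu 0 / (1 + α) ^ 2 * (s - t) * Real.log (h t)| ≤ C * ((s : ℝ) - t) ^ 2)
    {Ω : ℕ → Type*} [∀ N, MeasurableSpace (Ω N)] {P : ∀ N, Measure (Ω N)}
    {A : ∀ N, Fin 2 → Ω N → Measure ℝ} {S : ∀ N, Fin 2 → Ω N → Measure (ℝ × ℝ)}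
    {L : ∀ N, Ω N → ℝ≥0 → Fin 2 → ℕ}
    (hL : ∀ N, IsQueueSolution lam mu (P N) (A N) (S N) (L N))
    (hL₂ : ∀ N, ∀ᵐ ω ∂(P N), L N ω 0 1 = N)
    (hL₁ : ∀ ε : ℝ, 0 < ε →
      Tendsto (fun N : ℕ => P N {ω | ε ≤ |(L N ω 0 0 : ℝ) / (N : ℝ) ^ α - δ|}) atTop (𝓝 0))
    (T : ℝ≥0) {ε : ℝ} (hε : 0 < ε) :
    ∃ F : ∀ N, Set (Ω N), Tendsto (fun N => P N (F N)) atTop (𝓝 0) ∧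
      ∀ᶠ N : ℕ in atTop, ∀ᵐ ω ∂(P N), ω ∉ F N → ∀ t ≤ T,
        |(L N ω (((N : ℝ) ^ α * Real.log N).toNNReal * t) 0 : ℝ) / (N : ℝ) ^ α - h t| ≤ ε := by
  obtain ⟨η, hη, hcore⟩ := exists_tolerance hlam hmu hα hδ hl hC h0 hmem hexp T.2 hε
  have hη0 := hη.1
  set ℓ : ℕ → ℝ := fun N => Real.log N with hℓdef
  set m : ℕ → ℝ := fun N => (N : ℝ) ^ α with hmdef
  -- Constraints: `J ≫ ℓ` for the grid, `B ≪ m` for the blocks, and total noise `n J √B ≪ m` with `n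
  -- ≈ T m ℓ / B`, i.e. `B ≫ (ℓ J)²`. With `J ≈ ℓ²` and `B = ℓ⁸` the relative noise is of order
  -- `1/ℓ`.
  set B : ℕ → ℝ≥0 := fun N => (ℓ N ^ 8).toNNReal with hBdef
  set J : ℕ → ℕ := fun N => ⌈ℓ N ^ 2⌉₊ with hJdef
  -- The extra block makes `n B` exceed the horizon strictly; the overshoot is at most `B ≤ m ℓ`,
  -- whence the factor `T + 1`.
  set n : ℕ → ℕ := fun N => ⌊T * (m N * ℓ N) / B N⌋₊ + 1 with hndef
  have tN : Tendsto (fun N : ℕ => (N : ℝ)) atTop atTop := tendsto_natCast_atTop_atTop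
  have tℓ : Tendsto ℓ atTop atTop := Real.tendsto_log_atTop.comp tN
  have tm : Tendsto m atTop atTop := (tendsto_rpow_atTop hα).comp tN
  have tBm : Tendsto (fun N => ℓ N ^ 8 / m N) atTop (𝓝 0) := tendsto_log_pow_div_rpow hα 8
  -- Here `α < 1` enters: the horizon `m ℓ` is negligible against `N`, the initial size of the
  -- second queue.
  have tH : Tendsto (fun N => ℓ N ^ 1 / (N : ℝ) ^ (1 - α)) atTop (𝓝 0) :=
    tendsto_log_pow_div_rpow (sub_pos.2 hα1) 1
  set c₁ := lam 0 + mu 0 with hc₁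
  set c₂ := lam 1 + mu 1 with hc₂
  have hc₁0 : 0 < c₁ := add_pos (hlam 0) (hmu 0)
  have hc₂0 : 0 < c₂ := add_pos (hlam 1) (hmu 1)
  have hT1 : (0 : ℝ) < T + 1 := by positivity
  have hreg : ∀ᶠ N : ℕ in atTop, 0 < N ∧ 1 ≤ η * ℓ N ∧ 1 ≤ η * m N ∧ ℓ N ^ 8 ≤ η * m N ∧
      (c₂ + 1) * ((T + 1) * (m N * ℓ N)) ≤ η / 8 * N ∧ 1 ≤ η / 8 * N := by
    filter_upwards [eventually_gt_atTop 0, tℓ.eventually_ge_atTop (1 / η),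
      tm.eventually_ge_atTop (1 / η), tBm.eventually_le_const hη0,
      tH.eventually_le_const (show 0 < η / 8 / ((c₂ + 1) * (T + 1)) by positivity),
      tN.eventually_ge_atTop (1 / (η / 8))] with N h1 h2 h3 h4 h5 h6
    have hN' : (0 : ℝ) < N := by exact_mod_cast h1
    have hm0 : 0 < m N := Real.rpow_pos_of_pos hN' _
    refine ⟨h1, ?_, ?_, ?_, ?_, ?_⟩
    · rwa [div_le_iff₀' hη0] at h2
    · rwa [div_le_iff₀' hη0] at h3
    · rwa [div_le_iff₀ hm0] at h4
    · have e : (N : ℝ) = m N * (N : ℝ) ^ (1 - α) := by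
        simp only [hmdef]; rw [← Real.rpow_add hN']; simp
      rw [pow_one, div_le_iff₀ (Real.rpow_pos_of_pos hN' _), div_mul_eq_mul_div,
        le_div_iff₀ (by positivity)] at h5
      calc (c₂ + 1) * ((T + 1) * (m N * ℓ N)) = m N * (ℓ N * ((c₂ + 1) * (T + 1))) := by ring
        _ ≤ m N * (η / 8 * (N : ℝ) ^ (1 - α)) := by gcongr
        _ = η / 8 * (m N * (N : ℝ) ^ (1 - α)) := by ring
        _ = η / 8 * N := by rw [← e]
    · rwa [div_le_iff₀' (by positivity)] at h6
  have hsize : ∀ᶠ N : ℕ in atTop, 0 < (N : ℝ) ∧ 0 < m N ∧ 1 ≤ ℓ N ∧ (B N : ℝ) = ℓ N ^ 8 ∧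
      (n N * B N : ℝ) ≤ (T + 1) * (m N * ℓ N) ∧ T * (m N * ℓ N) < n N * B N ∧
      (J N : ℝ) ≤ ℓ N ^ 2 + 1 := by
    filter_upwards [hreg] with N ⟨h1, h2, h3, h4, h5, h6⟩
    have hN' : (0 : ℝ) < N := by exact_mod_cast h1
    have hm0 : 0 < m N := Real.rpow_pos_of_pos hN' _
    have hℓ0 : 0 < ℓ N := (mul_pos_iff_of_pos_left hη0).1 (one_pos.trans_le h2)
    have hℓ1 : 1 ≤ ℓ N := h2.trans (mul_le_of_le_one_left hℓ0.le hη.2)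
    have hB : (B N : ℝ) = ℓ N ^ 8 := Real.coe_toNNReal _ (by positivity)
    have hB0 : (0 : ℝ) < B N := by rw [hB]; positivity
    refine ⟨hN', hm0, hℓ1, hB, ?_, ?_, (Nat.ceil_lt_add_one (by positivity)).le⟩
    · have h7 : (⌊T * (m N * ℓ N) / B N⌋₊ : ℝ) ≤ T * (m N * ℓ N) / B N :=
        Nat.floor_le (by positivity)
      rw [le_div_iff₀ hB0] at h7
      have h8 : (B N : ℝ) ≤ m N * ℓ N := by
        rw [hB]
        exact (h4.trans (mul_le_of_le_one_left hm0.le hη.2)).trans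
          (le_mul_of_one_le_right hm0.le hℓ1)
      simp only [hndef]
      push_cast
      linarith
    · have h7 : T * (m N * ℓ N) / B N < ⌊T * (m N * ℓ N) / B N⌋₊ + 1 := Nat.lt_floor_add_one _
      rw [div_lt_iff₀ hB0] at h7
      simp only [hndef]
      push_cast
      exact h7
  set F₁ : ∀ N, Set (Ω N) := fun N => {ω | η ≤ |(L N ω 0 0 : ℝ) / m N - δ|} with hF₁
  set F₂ : ∀ N, Set (Ω N) := fun N => {ω | η * m N ≤ ∑ k ∈ Finset.range (n N),
    blockError (lam 0) (mu 0) (A N 0 ω) (S N 0 ω) (J N) ((k * B N : ℝ≥0) : ℝ)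
      (((k + 1 : ℕ) * B N : ℝ≥0) : ℝ)} with hF₂
  set F₃ : ∀ N, Set (Ω N) := fun N => {ω | η / 4 * N ≤
    blockError (lam 1) (mu 1) (A N 1 ω) (S N 1 ω) 1 0 ((n N * B N : ℝ≥0) : ℝ)} with hF₃
  have hP₂ : Tendsto (fun N => P N (F₂ N)) atTop (𝓝 0) := by
    refine tendsto_of_tendsto_of_tendsto_of_le_of_le' tendsto_const_nhds
      (tendsto_ofReal_div_of_tendsto_atTop tℓ (4 * (T + 1) * √c₁ / η))
      (Eventually.of_forall fun _ => zero_le) ?_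
    filter_upwards [hsize] with N ⟨hN, hm0, hℓ1, hB, hnB, _, hJ⟩
    have hℓ0 : 0 < ℓ N := one_pos.trans_le hℓ1
    have hB0 : 0 < B N := by rw [← NNReal.coe_pos, hB]; positivity
    refine ((hL N).measure_sum_blockError_ge_le hlam hmu 0
      (Nat.ceil_pos.2 (by positivity)) (n N) hB0 (mul_pos hη0 hm0)).trans
      (ENNReal.ofReal_le_ofReal ?_)
    have hsq : √((lam 0 + mu 0) * B N) = √c₁ * ℓ N ^ 4 := by
      rw [hB, Real.sqrt_mul hc₁0.le, show ℓ N ^ 8 = (ℓ N ^ 4) ^ 2 by ring,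
        Real.sqrt_sq (by positivity)]
    have hn : (n N : ℝ) ≤ (T + 1) * (m N * ℓ N) / ℓ N ^ 8 := by
      rw [le_div_iff₀ (by positivity), ← hB]; exact hnB
    have hJ' : (J N : ℝ) + 2 ≤ 4 * ℓ N ^ 2 := by
      have : 1 ≤ ℓ N ^ 2 := one_le_pow₀ hℓ1
      linarith
    rw [hsq]
    calc n N * ((J N + 2) * (√c₁ * ℓ N ^ 4)) / (η * m N)
        ≤ ((T + 1) * (m N * ℓ N) / ℓ N ^ 8) * ((4 * ℓ N ^ 2) * (√c₁ * ℓ N ^ 4)) / (η * m N) := by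
          gcongr
      _ = 4 * (T + 1) * √c₁ / η / ℓ N := by field_simp
  have hP₃ : Tendsto (fun N => P N (F₃ N)) atTop (𝓝 0) := by
    have tsN : Tendsto (fun N : ℕ => √(N : ℝ)) atTop atTop := Real.tendsto_sqrt_atTop.comp tN
    refine tendsto_of_tendsto_of_tendsto_of_le_of_le' tendsto_const_nhds
      (tendsto_ofReal_div_of_tendsto_atTop tsN (12 * √c₂ / η))
      (Eventually.of_forall fun _ => zero_le) ?_
    filter_upwards [hsize, hreg] with N ⟨hN, hm0, hℓ1, hB, hnB, _, _⟩ ⟨_, _, _, _, hH, _⟩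
    refine (measure_ge_le_of_lintegral_le ((hL N).measurable_blockError 1 1 _ _)
      (show 0 < η / 4 * (N : ℝ) by positivity) ((hL N).lintegral_blockError_le hlam hmu 1 one_pos
        le_rfl (NNReal.coe_nonneg _) (show 0 < c₂ * (N : ℝ) by positivity) ?_)).trans
      (ENNReal.ofReal_le_ofReal (le_of_eq ?_))
    · rw [sub_zero]
      gcongr
      push_cast
      have h1 : (T + 1) * (m N * ℓ N) ≤ (c₂ + 1) * ((T + 1) * (m N * ℓ N)) :=
        le_mul_of_one_le_left (by positivity) (by linarith)
      have h2 : η / 8 * N ≤ N := mul_le_of_le_one_left hN.le (by linarith [hη.2])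
      linarith
    · rw [Real.sqrt_mul hc₂0.le]
      have h1 : √(N : ℝ) * √(N : ℝ) = N := Real.mul_self_sqrt hN.le
      have h2 : 0 < √(N : ℝ) := Real.sqrt_pos.2 hN
      nth_rw 2 [← h1]
      push_cast
      field_simp
      ring
  refine ⟨fun N => F₁ N ∪ (F₂ N ∪ F₃ N), ?_, ?_⟩
  · refine tendsto_of_tendsto_of_tendsto_of_le_of_le tendsto_const_nhds
      (by simpa using (hL₁ η hη0).add (hP₂.add hP₃)) (fun _ => zero_le) fun N => ?_
    exact (measure_union_le _ _).trans (add_le_add le_rfl (measure_union_le _ _))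
  · filter_upwards [hsize, hreg] with N ⟨hN, hm0, hℓ1, hB, hnB, hTn, hJ⟩
      ⟨hN0, hℓη, hmη, hBη, hH, hHN⟩
    have hℓ0 : 0 < ℓ N := one_pos.trans_le hℓ1
    filter_upwards [(hL N).ae_isQueuePath hlam hmu, hL₂ N] with ω hpath hω2 hω t ht
    simp only [mem_union, not_or] at hω
    obtain ⟨hω₁, hω₂, hω₃⟩ := hω
    have hlog : Real.log (m N) = α * ℓ N := Real.log_rpow hN α
    have hJge : ℓ N ≤ η * J N := by
      have h1 : ℓ N ^ 2 ≤ J N := Nat.le_ceil _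
      have h2 := mul_le_mul_of_nonneg_left h1 hη0.le
      have h3 := mul_le_mul_of_nonneg_right hℓη hℓ0.le
      linarith
    have hHle : (lam 1 + mu 1) * ((n N * B N : ℝ≥0) : ℝ) + 1 ≤ η / 4 * N := by
      push_cast
      have h1 := mul_le_mul_of_nonneg_left hnB hc₂0.le
      have h2 : 0 ≤ (T + 1) * (m N * ℓ N) := by positivity
      linarith
    have h2 : ∀ s ≤ (n N : ℝ≥0) * B N, |Real.log (1 + L N ω s 1) - ℓ N| ≤ η := fun s hs =>
      hpath.abs_log_second_sub_le hlam hmu hN0 hω2 hη hHle (not_le.1 hω₃).le hs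
    refine hcore hpath hm0 hlog hℓη hmη (by rw [← NNReal.coe_pos, hB]; positivity)
      (by rw [hB]; exact hBη) (Nat.ceil_pos.2 (by positivity)) hJge hnB h2 (not_le.1 hω₁).le
      (not_le.1 hω₂).le t (lt_of_le_of_lt ?_ hTn)
    gcongr

theorem proposition3 (lam mu : Fin 2 → ℝ) (hlam : ∀ i, 0 < lam i) (hmu : ∀ i, 0 < mu i)
    (ρ₁ α δ : ℝ) (hρ₁ : ρ₁ = lam 0 / mu 0) (hρ : ρ₁ < 1 / 2) (hα : α = ρ₁ / (1 - ρ₁))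
    (hδ : δ ∈ Set.Ioc (0 : ℝ) 1)
    {Ω : ℕ → Type*} [∀ N, MeasurableSpace (Ω N)] (P : ∀ N, Measure (Ω N))
    [∀ N, IsProbabilityMeasure (P N)]
    (A : ∀ N, Fin 2 → Ω N → Measure ℝ) (S : ∀ N, Fin 2 → Ω N → Measure (ℝ × ℝ))
    (L : ∀ N, Ω N → ℝ≥0 → Fin 2 → ℕ)
    (hL : ∀ N, IsQueueSolution lam mu (P N) (A N) (S N) (L N))
    (hL₂ : ∀ N, ∀ᵐ ω ∂(P N), L N ω 0 1 = N)
    (hL₁ : ∀ ε : ℝ, 0 < ε →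
      Tendsto (fun N : ℕ => P N {ω | ε ≤ |(L N ω 0 0 : ℝ) / (N : ℝ) ^ α - δ|}) atTop (𝓝 0)) :
    ∃ h : ℝ≥0 → ℝ, (∀ g, IsFluidFunction δ (mu 0) α g ↔ g = h) ∧
      ∃ hc : Continuous h,
        ConvergesInLaw P
          (fun N ω => scaledFirst (L N ω) ((hL N).cadlag ω)
            ((N : ℝ) ^ α * Real.log N).toNNReal ((N : ℝ) ^ α))
          (Measure.dirac (CadlagPath.ofContinuous h hc)) := by
  have hμ := hmu 0
  have hρ0 : 0 < ρ₁ := hρ₁ ▸ div_pos (hlam 0) hμ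
  have h1ρ : 0 < 1 - ρ₁ := by linarith
  have hα0 : 0 < α := hα ▸ div_pos hρ0 h1ρ
  have hα1 : α < 1 := by rw [hα, div_lt_one h1ρ]; linarith
  -- `α / (1 + α) = ρ₁`: at size `N^α` the first queue gets, to leading order, exactly the share
  -- matching its load.
  have hl : lam 0 = α / (1 + α) * mu 0 := by
    have h1 : α / (1 + α) = ρ₁ := by rw [hα]; field_simp; ring
    rw [h1, hρ₁, div_mul_cancel₀ _ hμ.ne']
  obtain ⟨h, C, hC, huniq, h0, hmem, hexp⟩ := exists_fluidFunction hδ hμ hα0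
  have hcont : Continuous h := by
    refine LipschitzWith.continuous (K := C.toNNReal) (LipschitzWith.of_dist_le_mul fun t s => ?_)
    rw [Real.coe_toNNReal _ hC, Real.dist_eq, NNReal.dist_eq]
    rcases le_total t s with hts | hts
    · rw [abs_sub_comm, abs_sub_comm (t : ℝ), abs_of_nonneg (sub_nonneg.2 (NNReal.coe_le_coe.2 hts))]
      exact (hexp t s hts).1
    · rw [abs_of_nonneg (sub_nonneg.2 (NNReal.coe_le_coe.2 hts))]
      exact (hexp s t hts).1
  refine ⟨h, huniq, hcont, convergesInLaw_dirac
    (fun N => measurable_scaledFirst (hL N).measurable _ _ _) fun T ε hε => ?_⟩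
  exact exists_failureSet hlam hmu hα0 hα1 hδ hl hC h0 hmem hexp hL hL₂ hL₁ T hε
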